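/- Fix a finite alphabet $A$. A class $\mathcal C$ of languages over $A$ (a set of subsets of $A^*$) is a prevariety if it contains only regular languages, contains $\emptyset$ and $A^*$, is closed under union, intersection and complement, and contains $u^{-1}L=\{w\in A^*\mid uw\in L\}$ and $Lu^{-1}=\{w\in A^*\mid wu\in L\}$ for all $L\in\mathcal C$ and $u\in A^*$. The star-free closure $\mathrm{SF}(\mathcal C)$ is the least class of languages that contains $\mathcal C$ and the singletons $\{a\}$ for $a\in A$ and is closed under union, complement and concatenation. Let $\mathcal D$ be a class of languages over $A$. The $\mathcal D$-separation problem takes as input two regular languages $L_1,L_2$ (each given by a nondeterministic finite automaton) and asks whether there is $K\in\mathcal D$ with $L_1\subseteq K$ and $L_2\cap K=\emptyset$. The $\mathcal D$-covering problem takes as input a regular language $L_1$ and a finite set $\mathbf L_2$ of regular languages (all given by nondeterministic finite automata) and asks whether there is a finite set $\mathbf K\subseteq\mathcal D$ such that $L_1\subseteq\bigcup_{K\in\mathbf K}K$ and every $K\in\mathbf K$ satisfies $K\cap L=\emptyset$ for some $L\in\mathbf L_2$. Corollary 9.3. For every prevariety $\mathcal C$ that contains only finitely many languages, the $\mathrm{SF}(\mathcal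 C)$-covering problem and the $\mathrm{SF}(\mathcal C)$-separation problem are decidable. In particular, the covering problem is decidable for the class of star-free languages, i.e. the languages defined by expressions built from $\emptyset$, $\varepsilon$ and the letters of $A$ using union, concatenation and complement. -/

import Mathlib

namespace StarFreeClosure

variable {A : Type*}

/-- The right quotient `L u⁻¹ = {w | w u ∈ L}`
(the left quotient `u⁻¹ L = {w | u w ∈ L}` is Mathlib's `Language.leftQuotient L u`). -/
def rightQuotient (L : Language A) (u : List A) : Language A :=
  {w | w ++ u ∈ L}

/-- A prevariety: a quotient-closed Boolean algebra of regular languages over the alphabet `A`.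
`⊥`, `⊤`, `⊔`, `⊓` and `ᶜ` are the set-theoretic notions on languages. -/
structure IsPrevariety (C : Set (Language A)) : Prop where
  empty_mem : (⊥ : Language A) ∈ C
  univ_mem : (⊤ : Language A) ∈ C
  union_mem : ∀ K ∈ C, ∀ L ∈ C, K ⊔ L ∈ C
  inter_mem : ∀ K ∈ C, ∀ L ∈ C, K ⊓ L ∈ C
  compl_mem : ∀ K ∈ C, Kᶜ ∈ C
  leftQuotient_mem : ∀ L ∈ C, ∀ u : List A, L.leftQuotient u ∈ C
  rightQuotient_mem : ∀ L ∈ C, ∀ u : List A, rightQuotient L u ∈ C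
  regular : ∀ L ∈ C, L.IsRegular

/-- Membership in the star-free closure of `C`: the least class that contains `C` and all
singletons `{a}` (`a` a letter) and is closed under union, complement and concatenation. -/
inductive InSF (C : Set (Language A)) : Language A → Prop
  | base (L : Language A) : L ∈ C → InSF C L
  | letter (a : A) : InSF C {[a]}
  | union (K L : Language A) : InSF C K → InSF C L → InSF C (K ⊔ L)
  | compl (K : Language A) : InSF C K → InSF C Kᶜ
  | concat (K L : Language A) : InSF C K → InSF C L → InSF C (K * L)

/-- The star-free closure `SF(C)` of a class `C`. -/
def SF (C : Set (Language A)) : Set (Language A) :=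
  {L | InSF C L}

/-- Star-free expressions: regular expressions without Kleene star, but with complement. -/
inductive StarFreeExpr (A : Type*)
  | empty : StarFreeExpr A
  | epsilon : StarFreeExpr A
  | letter (a : A) : StarFreeExpr A
  | union (e f : StarFreeExpr A) : StarFreeExpr A
  | concat (e f : StarFreeExpr A) : StarFreeExpr A
  | compl (e : StarFreeExpr A) : StarFreeExpr A

/-- The language defined by a star-free expression. -/
def StarFreeExpr.language : StarFreeExpr A → Language A
  | .empty => ⊥
  | .epsilon => {[]}
  | .letter a => {[a]}
  | .union e f => e.language ⊔ f.language
  | .concat e f => e.language * f.language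
  | .compl e => e.languageᶜ

/-- The class of star-free languages. -/
def starFreeLanguages (A : Type*) : Set (Language A) :=
  {L | ∃ e : StarFreeExpr A, e.language = L}

/-- `L₁` is `D`-separable from `L₂`: some `K ∈ D` satisfies `L₁ ⊆ K` and `L₂ ∩ K = ∅`. -/
def Separable (D : Set (Language A)) (L₁ L₂ : Language A) : Prop :=
  ∃ K ∈ D, L₁ ≤ K ∧ L₂ ⊓ K = ⊥

/-- `Ks` is a cover of `L`: a finite set of languages whose union contains `L`. -/
def IsCover (L : Language A) (Ks : Set (Language A)) : Prop :=
  Ks.Finite ∧ ∀ w ∈ L, ∃ K ∈ Ks, w ∈ K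

/-- `Ks` is separating for `Ls`: every `K ∈ Ks` is disjoint from some `L ∈ Ls`. -/
def IsSeparating (Ks Ls : Set (Language A)) : Prop :=
  ∀ K ∈ Ks, ∃ L ∈ Ls, K ⊓ L = ⊥

/-- `(L₁, Ls₂)` is `D`-coverable: some cover of `L₁` by languages of `D` is separating for `Ls₂`. -/
def Coverable (D : Set (Language A)) (L₁ : Language A) (Ls₂ : Set (Language A)) : Prop :=
  ∃ Ks : Set (Language A), IsCover L₁ Ks ∧ Ks ⊆ D ∧ IsSeparating Ks Ls₂

/-- A finite description of a nondeterministic finite automaton over `A`, with natural numbers as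
names of states: the list of transitions `(p, a, q)`, the list of initial states and the list of
accepting states. -/
abbrev AutomatonCode (A : Type*) :=
  List (ℕ × A × ℕ) × List ℕ × List ℕ

/-- The automaton described by a code. Only the finitely many states that occur in the code are
relevant to the language that it accepts. -/
def AutomatonCode.toNFA (c : AutomatonCode A) : NFA A ℕ where
  step p a := {q | (p, a, q) ∈ c.1}
  start := {q | q ∈ c.2.1}
  accept := {q | q ∈ c.2.2}

/-- The regular language described by a code. -/
def AutomatonCode.language (c : AutomatonCode A) : Language A :=
  (AutomatonCode.toNFA c).accepts

/-- `D`-separation is decidable: an algorithm decides, given (automata for) two regular languages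
`L₁` and `L₂`, whether `L₁` is `D`-separable from `L₂`. -/
def SeparationDecidable [Primcodable A] (D : Set (Language A)) : Prop :=
  ComputablePred fun x : AutomatonCode A × AutomatonCode A =>
    Separable D (AutomatonCode.language x.1) (AutomatonCode.language x.2)

/-- `D`-covering is decidable: an algorithm decides, given (automata for) a regular language `L₁`
and a finite set `Ls₂` of regular languages, whether `(L₁, Ls₂)` is `D`-coverable. -/
def CoveringDecidable [Primcodable A] (D : Set (Language A)) : Prop :=
  ComputablePred fun x : AutomatonCode A × List (AutomatonCode A) =>
    Coverable D (AutomatonCode.language x.1) {L | ∃ c ∈ x.2, AutomatonCode.language c = L}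

end StarFreeClosure

-- Let `η : A* → N` be the syntactic map of `C`. The monoid `N` is finite, and every language
-- recognized by `η` lies in `SF C`. For a given input, let `α : A* → M` be the syntactic map of the
-- input languages. In the finite monoid `N × Set M`, `PumpClosure` is generated by the pairs `(η
-- [a], {α [a]})` under products and under `pump`, which sends `(n, T)` with `n` idempotent to `(n,
-- T ^ e ∪ T ^ (e + 1))`; here `e` makes all `e`-th powers idempotent. By `coverable_iff`, a
-- separating cover exists unless 1 or some element of the closure is an obstruction: its second
-- component meets the `α`-image of every input language.
--
-- An obstruction excludes covers because languages of `SF C` cannot count high powers of a word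
-- with idempotent label (`InSF.exists_wordPow_iff`). Hence all members of the second component are
-- images of words that a given finite family in `SF C` does not tell apart
-- (`PumpClosure.exists_realizedBy`).
--
-- Conversely, `hasBound` colours words by elements of the closure (or 1) so that each colour class
-- is in `SF C` and the second component of the colour of `w` contains `α w`. Without obstruction,
-- the classes whose colour meets `L₁` form a separating cover. The colouring comes from a double
-- induction on the closed set of values and on the alphabet: a letter whose right multiplication
-- misses some value serves as a delimiter, and words of blocks are read over a new alphabet with a
-- smaller set of values.
--
-- Finally the closure is computable by saturation. Subsets of `M` are represented by lists of
-- words, so `M` is never constructed; a bound on its cardinality gives both `e` and the number of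
-- rounds. Separation is covering with a single language, and the star-free languages are the case
-- `C = {∅, A*}`.

universe u

namespace StarFreeClosure

open scoped Pointwise

/-! ### Boolean closure properties of `SF C`. -/

section ClosureProperties

variable {A : Type*} {C : Set (Language A)}

theorem InSF.inter {K L : Language A} (hK : InSF C K) (hL : InSF C L) : InSF C (K ⊓ L) := by
  have h : K ⊓ L = (Kᶜ ⊔ Lᶜ)ᶜ := by rw [compl_sup, compl_compl, compl_compl]
  rw [h]
  exact .compl _ (.union _ _ (.compl _ hK) (.compl _ hL))

theorem InSF.biUnion {ι : Type*} {s : Set ι} (hs : s.Finite) {f : ι → Language A}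
    (h0 : InSF C ⊥) (hf : ∀ i ∈ s, InSF C (f i)) : InSF C {w | ∃ i ∈ s, w ∈ f i} := by
  induction s, hs using Set.Finite.induction_on with
  | empty =>
    have h : ({w | ∃ i ∈ (∅ : Set ι), w ∈ f i} : Language A) = ⊥ :=
      Set.eq_empty_of_forall_notMem fun w ⟨_, hi, _⟩ => hi
    rwa [h]
  | @insert a s _ _ ih =>
    have h : ({w | ∃ i ∈ insert a s, w ∈ f i} : Language A) = f a ⊔ {w | ∃ i ∈ s, w ∈ f i} := by
      ext w
      constructor
      · rintro ⟨i, rfl | hi, hw⟩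
        · exact Or.inl hw
        · exact Or.inr ⟨i, hi, hw⟩
      · rintro (hw | ⟨i, hi, hw⟩)
        · exact ⟨a, Or.inl rfl, hw⟩
        · exact ⟨i, Or.inr hi, hw⟩
    rw [h]
    exact .union _ _ (hf a (Or.inl rfl)) (ih fun i hi => hf i (Or.inr hi))

/-- The words all of whose letters belong to `S`. -/
def wordsOver (S : Set A) : Language A :=
  {w | ∀ a ∈ w, a ∈ S}

theorem mem_wordsOver {S : Set A} {w : List A} : w ∈ wordsOver S ↔ ∀ a ∈ w, a ∈ S :=
  Iff.rfl

theorem append_mem_wordsOver {S : Set A} {u v : List A} :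
    u ++ v ∈ wordsOver S ↔ u ∈ wordsOver S ∧ v ∈ wordsOver S := by
  simp only [mem_wordsOver, List.mem_append]
  exact ⟨fun h => ⟨fun a ha => h a (Or.inl ha), fun a ha => h a (Or.inr ha)⟩,
    fun h a ha => ha.elim (h.1 a) (h.2 a)⟩

theorem cons_mem_wordsOver {S : Set A} {a : A} {v : List A} :
    a :: v ∈ wordsOver S ↔ a ∈ S ∧ v ∈ wordsOver S := by
  simp [mem_wordsOver]

theorem nil_mem_wordsOver {S : Set A} : [] ∈ wordsOver S := by
  simp [mem_wordsOver]

theorem InSF.wordsOver [Finite A] (h0 : InSF C ⊥) (h1 : InSF C ⊤) (S : Set A) :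
    InSF C (wordsOver S) := by
  have h : StarFreeClosure.wordsOver S =
      ({w | ∃ a ∈ Sᶜ, w ∈ (⊤ : Language A) * ({[a]} : Language A) * ⊤} : Language A)ᶜ := by
    ext w
    change (∀ a ∈ w, a ∈ S) ↔ ¬ ∃ a ∈ Sᶜ, w ∈ (⊤ : Language A) * ({[a]} : Language A) * ⊤
    constructor
    · rintro h ⟨a, ha, hw⟩
      obtain ⟨x, ⟨y, -, z, rfl, rfl⟩, v, -, rfl⟩ := hw
      exact ha (h a (by simp))
    · intro h a ha
      by_contra haS
      obtain ⟨s, t, rfl⟩ := List.append_of_mem ha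
      exact h ⟨a, haS, s ++ [a], ⟨s, trivial, [a], rfl, rfl⟩, t, trivial, by simp⟩
  rw [h]
  exact .compl _ (.biUnion (Set.toFinite _) h0
    fun a _ => .concat _ _ (.concat _ _ h1 (.letter a)) h1)

theorem InSF.nil [Finite A] (h0 : InSF C ⊥) (h1 : InSF C ⊤) : InSF C {[]} := by
  convert InSF.wordsOver h0 h1 (∅ : Set A)
  ext w
  change w = [] ↔ ∀ a ∈ w, a ∈ (∅ : Set A)
  simp [List.eq_nil_iff_forall_not_mem]

/-- The languages that are inverse images of subsets of `N` under `η`. -/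
def recognized {N : Type*} (η : List A → N) : Set (Language A) :=
  {L | ∃ F : Set N, L = {w | η w ∈ F}}

theorem InSF.recognized_bot {N : Type*} (η : List A → N) : InSF (recognized η) ⊥ :=
  .base _ ⟨∅, rfl⟩

theorem InSF.recognized_top {N : Type*} (η : List A → N) : InSF (recognized η) ⊤ :=
  .base _ ⟨Set.univ, rfl⟩

end ClosureProperties

/-! ### Factorization of words into blocks delimited by a letter. -/

section Blocks

variable {A : Type*}

/-- The concatenation of the words of `us`, each followed by the letter `b`. -/
def joinBlocks (b : A) (us : List (List A)) : List A :=
  (us.map (· ++ [b])).flatten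

@[simp]
theorem joinBlocks_nil (b : A) : joinBlocks b [] = [] := rfl

@[simp]
theorem joinBlocks_cons (b : A) (u : List A) (us : List (List A)) :
    joinBlocks b (u :: us) = u ++ b :: joinBlocks b us := by
  simp [joinBlocks]

@[simp]
theorem joinBlocks_append (b : A) (us vs : List (List A)) :
    joinBlocks b (us ++ vs) = joinBlocks b us ++ joinBlocks b vs := by
  simp [joinBlocks]

theorem append_cons_inj_of_notMem {b : A} {u u' v v' : List A} (hu : b ∉ u) (hu' : b ∉ u')
    (h : u ++ b :: v = u' ++ b :: v') : u = u' ∧ v = v' := by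
  induction u generalizing u' with
  | nil =>
    cases u' with
    | nil => simpa using h
    | cons x u' =>
      simp only [List.nil_append, List.cons_append, List.cons.injEq] at h
      exact absurd h.1 (by rintro rfl; simp at hu')
  | cons y u ih =>
    cases u' with
    | nil =>
      simp only [List.nil_append, List.cons_append, List.cons.injEq] at h
      exact absurd h.1 (by rintro rfl; simp at hu)
    | cons x u' =>
      simp only [List.cons_append, List.cons.injEq] at h
      obtain ⟨rfl, h⟩ := h
      obtain ⟨rfl, rfl⟩ := ih (fun hb => hu (by simp [hb])) (fun hb => hu' (by simp [hb])) h
      exact ⟨rfl, rfl⟩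

theorem joinBlocks_injOn {b : A} {us vs : List (List A)} (hu : ∀ u ∈ us, b ∉ u)
    (hv : ∀ v ∈ vs, b ∉ v) (h : joinBlocks b us = joinBlocks b vs) : us = vs := by
  induction us generalizing vs with
  | nil => cases vs <;> simp_all
  | cons u us ih =>
    cases vs with
    | nil => simp at h
    | cons v vs =>
      rw [joinBlocks_cons, joinBlocks_cons] at h
      obtain ⟨rfl, h'⟩ := append_cons_inj_of_notMem (hu u (by simp)) (hv v (by simp)) h
      rw [ih (fun w hw => hu w (List.mem_cons_of_mem _ hw))
        (fun w hw => hv w (List.mem_cons_of_mem _ hw)) h']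

theorem joinBlocks_append_inj {b : A} {us vs : List (List A)} {u v : List A}
    (hus : ∀ u ∈ us, b ∉ u) (hvs : ∀ v ∈ vs, b ∉ v) (hu : b ∉ u) (hv : b ∉ v)
    (h : joinBlocks b us ++ u = joinBlocks b vs ++ v) : us = vs ∧ u = v := by
  have h' : joinBlocks b (us ++ [u]) = joinBlocks b (vs ++ [v]) := by
    have := congrArg (· ++ [b]) h
    simpa using this
  have := joinBlocks_injOn (by simpa [or_imp, forall_and] using ⟨hus, hu⟩)
    (by simpa [or_imp, forall_and] using ⟨hvs, hv⟩) h'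
  have h2 := List.append_inj' this rfl
  exact ⟨h2.1, by simpa using h2.2⟩

theorem exists_joinBlocks_append (b : A) {S : Set A} {w : List A} (hw : w ∈ wordsOver S) :
    ∃ us u, (∀ v ∈ us, v ∈ wordsOver (S \ {b})) ∧ u ∈ wordsOver (S \ {b}) ∧
      w = joinBlocks b us ++ u := by
  induction w with
  | nil => exact ⟨[], [], by simp, nil_mem_wordsOver, rfl⟩
  | cons a w ih =>
    rw [cons_mem_wordsOver] at hw
    obtain ⟨us, u, hus, hu, rfl⟩ := ih hw.2
    by_cases hab : a = b
    · subst hab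
      exact ⟨[] :: us, u, by simpa [nil_mem_wordsOver] using hus, hu, by simp⟩
    · have ha : a ∈ S \ {b} := ⟨hw.1, hab⟩
      cases us with
      | nil => exact ⟨[], a :: u, by simp, cons_mem_wordsOver.2 ⟨ha, hu⟩, by simp⟩
      | cons v us =>
        refine ⟨(a :: v) :: us, u, ?_, hu, by simp⟩
        simp only [List.mem_cons, forall_eq_or_imp] at hus ⊢
        exact ⟨cons_mem_wordsOver.2 ⟨ha, hus.1⟩, hus.2⟩

theorem notMem_of_mem_wordsOver_diff {S : Set A} {b : A} {u : List A}
    (hu : u ∈ wordsOver (S \ {b})) : b ∉ u :=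
  fun hb => (hu b hb).2 rfl

theorem joinBlocks_mem_wordsOver {S : Set A} {b : A} (hb : b ∈ S) {us : List (List A)}
    (hus : ∀ u ∈ us, u ∈ wordsOver (S \ {b})) : joinBlocks b us ∈ wordsOver S := by
  induction us with
  | nil => exact nil_mem_wordsOver
  | cons u us ih =>
    simp only [List.mem_cons, forall_eq_or_imp] at hus
    rw [joinBlocks_cons, append_mem_wordsOver, cons_mem_wordsOver]
    exact ⟨fun a ha => (hus.1 a ha).1, hb, ih hus.2⟩

/-- The inverse image of `L` under the map which reads `joinBlocks b [u₁, …, uᵣ]`, where the `uᵢ`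
are words over `S` without `b`, as the word `k u₁ ⋯ k uᵣ`. -/
def blockPreimage {D : Type*} (b : A) (S : Set A) (k : List A → D) (L : Language D) :
    Language A :=
  {w | ∃ us, (∀ u ∈ us, u ∈ wordsOver (S \ {b})) ∧ w = joinBlocks b us ∧ us.map k ∈ L}

variable {D : Type*} {b : A} {S : Set A} {k : List A → D}

theorem blockPreimage_sup (K L : Language D) :
    blockPreimage b S k (K ⊔ L) = blockPreimage b S k K ⊔ blockPreimage b S k L := by
  ext w
  constructor
  · rintro ⟨us, hus, rfl, h | h⟩
    · exact Or.inl ⟨us, hus, rfl, h⟩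
    · exact Or.inr ⟨us, hus, rfl, h⟩
  · rintro (⟨us, hus, rfl, h⟩ | ⟨us, hus, rfl, h⟩)
    · exact ⟨us, hus, rfl, Or.inl h⟩
    · exact ⟨us, hus, rfl, Or.inr h⟩

theorem blockPreimage_mul (K L : Language D) :
    blockPreimage b S k (K * L) = blockPreimage b S k K * blockPreimage b S k L := by
  ext w
  constructor
  · rintro ⟨us, hus, rfl, p, hp, q, hq, h⟩
    obtain ⟨us, vs, rfl, rfl, rfl⟩ := List.map_eq_append_iff.1 h.symm
    simp only [List.mem_append, or_imp, forall_and] at hus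
    exact ⟨_, ⟨us, hus.1, rfl, hp⟩, _, ⟨vs, hus.2, rfl, hq⟩, (joinBlocks_append _ _ _).symm⟩
  · rintro ⟨_, ⟨us, hus, rfl, hp⟩, _, ⟨vs, hvs, rfl, hq⟩, rfl⟩
    refine ⟨us ++ vs, ?_, (joinBlocks_append _ _ _).symm, _, hp, _, hq, by simp⟩
    simpa only [List.mem_append, or_imp, forall_and] using ⟨hus, hvs⟩

theorem blockPreimage_singleton (c : D) :
    blockPreimage b S k {[c]} = (wordsOver (S \ {b}) ⊓ {u | k u = c}) * {[b]} := by
  ext w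
  constructor
  · rintro ⟨us, hus, rfl, h⟩
    obtain ⟨u, rfl, rfl⟩ := List.map_eq_singleton_iff.1 h
    exact ⟨u, ⟨hus u (by simp), rfl⟩, [b], rfl, by simp⟩
  · rintro ⟨u, ⟨hu, rfl⟩, _, rfl, rfl⟩
    exact ⟨[u], by rintro _ (_ | ⟨_, ⟨⟩⟩); exact hu, by simp, rfl⟩

/-- The factorization into `b`-free blocks is unique, so a word cannot be read both as a word inside
`L` and as one outside. -/
theorem blockPreimage_compl (L : Language D) :
    blockPreimage b S k Lᶜ = blockPreimage b S k ⊤ ⊓ (blockPreimage b S k L)ᶜ := by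
  ext w
  constructor
  · rintro ⟨us, hus, rfl, h⟩
    refine ⟨⟨us, hus, rfl, trivial⟩, ?_⟩
    rintro ⟨vs, hvs, h1, h2⟩
    have := joinBlocks_injOn (fun u hu => notMem_of_mem_wordsOver_diff (hus u hu))
      (fun u hu => notMem_of_mem_wordsOver_diff (hvs u hu)) h1
    subst this
    exact h h2
  · rintro ⟨⟨us, hus, rfl, -⟩, h⟩
    exact ⟨us, hus, rfl, fun h' => h ⟨us, hus, rfl, h'⟩⟩

theorem blockPreimage_top (hb : b ∈ S) :
    blockPreimage b S k ⊤ = wordsOver S ⊓ ({[]} ⊔ ⊤ * {[b]}) := by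
  ext w
  constructor
  · rintro ⟨us, hus, rfl, -⟩
    refine ⟨joinBlocks_mem_wordsOver hb hus, ?_⟩
    rcases List.eq_nil_or_concat us with rfl | ⟨us, u, rfl⟩
    · exact Or.inl rfl
    · exact Or.inr ⟨joinBlocks b us ++ u, trivial, [b], rfl, by simp⟩
  · rintro ⟨hw, rfl | ⟨v, -, _, rfl, rfl⟩⟩
    · exact ⟨[], by simp, rfl, trivial⟩
    · obtain ⟨us, u, hus, hu, rfl⟩ :=
        exists_joinBlocks_append b (append_mem_wordsOver.1 hw).1
      refine ⟨us ++ [u], ?_, by simp, trivial⟩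
      simpa [or_imp, forall_and] using ⟨hus, hu⟩

end Blocks

/-- Star-free descriptions over the alphabet `D` of block colours pull back to the original
alphabet: the inverse image commutes with all operations, so only letters (`hk`) and base languages
(`hC`) need hypotheses. -/
theorem InSF.blockPreimage {A D : Type*} [Finite A] {C : Set (Language A)}
    {C' : Set (Language D)} {b : A} {S : Set A} {k : List A → D} (h0 : InSF C ⊥) (h1 : InSF C ⊤)
    (hb : b ∈ S) (hk : ∀ c, InSF C (StarFreeClosure.wordsOver (S \ {b}) ⊓ {u | k u = c}))
    (hC : ∀ L ∈ C', InSF C (StarFreeClosure.blockPreimage b S k L)) {L : Language D}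
    (hL : InSF C' L) : InSF C (StarFreeClosure.blockPreimage b S k L) := by
  induction hL with
  | base L hL => exact hC L hL
  | letter a =>
    rw [blockPreimage_singleton]
    exact .concat _ _ (hk a) (.letter b)
  | union K L _ _ hK hL =>
    rw [blockPreimage_sup]
    exact .union _ _ hK hL
  | compl K _ hK =>
    rw [blockPreimage_compl, blockPreimage_top hb]
    exact .inter (.inter (.wordsOver h0 h1 S)
      (.union _ _ (.nil h0 h1) (.concat _ _ h1 (.letter b)))) (.compl _ hK)
  | concat K L _ _ hK hL =>
    rw [blockPreimage_mul]
    exact .concat _ _ hK hL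

/-! ### Labelled sets, pumping, and colourings that bound products. -/

section LabelledSets

variable {N M : Type*}

/-- Two labelled sets are comparable if they have the same label. -/
def Below (x y : N × Set M) : Prop :=
  x.1 = y.1 ∧ x.2 ⊆ y.2

theorem Below.refl (x : N × Set M) : Below x x := ⟨rfl, subset_rfl⟩

theorem Below.trans {x y z : N × Set M} (h : Below x y) (h' : Below y z) : Below x z :=
  ⟨h.1.trans h'.1, h.2.trans h'.2⟩

variable [Monoid N] [Monoid M]

theorem Below.mul {x y x' y' : N × Set M} (h : Below x y) (h' : Below x' y') :
    Below (x * x') (y * y') :=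
  ⟨congrArg₂ _ h.1 h'.1, Set.mul_subset_mul h.2 h'.2⟩

/-- The operation `(n, T) ↦ (n, T ^ e ∪ T ^ (e + 1))`, of interest when `n` is idempotent and `e`
is such that `T ^ e` is idempotent. -/
def pump (e : ℕ) (x : N × Set M) : N × Set M :=
  (x.1, x.2 ^ e ∪ x.2 ^ (e + 1))

theorem pow_eq_self_of_mul_self {n : N} (hn : n * n = n) {e : ℕ} (he : e ≠ 0) : n ^ e = n :=
  IsIdempotentElem.pow_eq hn he

theorem below_pump {e : ℕ} (he : e ≠ 0) {x : N × Set M} (hx : x.1 * x.1 = x.1) :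
    Below (x ^ e) (pump e x) :=
  ⟨pow_eq_self_of_mul_self hx he, Set.subset_union_left⟩

theorem below_pump_succ (e : ℕ) {x : N × Set M} (hx : x.1 * x.1 = x.1) :
    Below (x ^ (e + 1)) (pump e x) :=
  ⟨pow_eq_self_of_mul_self hx e.succ_ne_zero, Set.subset_union_right⟩

theorem pump_mul_pow {e : ℕ} (he : e ≠ 0) {x : N × Set M} (hx : x.1 * x.1 = x.1)
    (hxe : x ^ e * x ^ e = x ^ e) : pump e x * x ^ e = pump e x := by
  have h2 : x.2 ^ e * x.2 ^ e = x.2 ^ e := congrArg Prod.snd hxe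
  ext1
  · change x.1 * x.1 ^ e = x.1
    rw [pow_eq_self_of_mul_self hx he, hx]
  · change (x.2 ^ e ∪ x.2 ^ (e + 1)) * x.2 ^ e = x.2 ^ e ∪ x.2 ^ (e + 1)
    rw [Set.union_mul, pow_succ', mul_assoc, h2]

theorem pump_one (e : ℕ) : pump e (1 : N × Set M) = 1 := by
  simp [pump]

/-- Sets of labelled sets that are closed under multiplication and under pumping. -/
structure IsPumpClosed (e : ℕ) (Q : Set (N × Set M)) : Prop where
  mul_mem : ∀ x ∈ Q, ∀ y ∈ Q, x * y ∈ Q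
  pump_mem : ∀ x ∈ Q, x.1 * x.1 = x.1 → pump e x ∈ Q

namespace IsPumpClosed

variable {e : ℕ} {Q : Set (N × Set M)}

theorem mul_mem_left (hQ : IsPumpClosed e Q) {x y : N × Set M} (hx : x ∈ Q) (hy : y ∈ insert 1 Q) : x * y ∈ Q := by
  rcases hy with rfl | hy
  · rwa [mul_one]
  · exact hQ.mul_mem x hx y hy

theorem mul_mem_right (hQ : IsPumpClosed e Q) {x y : N × Set M} (hx : x ∈ insert 1 Q) (hy : y ∈ Q) : x * y ∈ Q := by
  rcases hx with rfl | hx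
  · rwa [one_mul]
  · exact hQ.mul_mem x hx y hy

theorem mul_mem_insert (hQ : IsPumpClosed e Q) {x y : N × Set M} (hx : x ∈ insert 1 Q) (hy : y ∈ insert 1 Q) :
    x * y ∈ insert 1 Q := by
  rcases hx with rfl | hx
  · rwa [one_mul]
  · exact Or.inr (hQ.mul_mem_left hx hy)

theorem pow_mem_insert (hQ : IsPumpClosed e Q) {x : N × Set M} (hx : x ∈ insert 1 Q) (n : ℕ) : x ^ n ∈ insert 1 Q := by
  induction n with
  | zero => exact Or.inl (pow_zero x)
  | succ n ih => rw [pow_succ]; exact hQ.mul_mem_insert ih hx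

theorem pump_mem_insert (hQ : IsPumpClosed e Q) {x : N × Set M} (hx : x ∈ insert 1 Q) (h : x.1 * x.1 = x.1) :
    pump e x ∈ insert 1 Q := by
  rcases hx with rfl | hx
  · exact Or.inl (pump_one e)
  · exact Or.inr (hQ.pump_mem x hx h)

theorem prod_mem_insert (hQ : IsPumpClosed e Q) {B : Type*} {g : B → N × Set M} {S : Set B} (hg : ∀ b ∈ S, g b ∈ Q)
    {w : List B} (hw : w ∈ wordsOver S) : (w.map g).prod ∈ insert 1 Q := by
  induction w with
  | nil => exact Or.inl rfl
  | cons b w ih =>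
    rw [cons_mem_wordsOver] at hw
    rw [List.map_cons, List.prod_cons]
    exact hQ.mul_mem_insert (Or.inr (hg b hw.1)) (ih hw.2)

theorem image_mul_subset (hQ : IsPumpClosed e Q) {c : N × Set M} (hc : c ∈ Q) : (· * c) '' insert 1 Q ⊆ Q := by
  rintro _ ⟨x, hx, rfl⟩
  exact hQ.mul_mem_right hx hc

/-- A pumped element absorbs `(x * c) ^ e` on the right, so it can be rewritten to end in `c`. This
makes the smaller set of values available to the induction in `hasBound`. -/
theorem image_mul (hQ : IsPumpClosed e Q) (he : e ≠ 0) (hp : ∀ x : N × Set M, x ^ e * x ^ e = x ^ e) {c : N × Set M}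
    (hc : c ∈ Q) : IsPumpClosed e ((· * c) '' insert 1 Q) where
  mul_mem := by
    rintro _ ⟨x, hx, rfl⟩ _ ⟨y, hy, rfl⟩
    exact ⟨x * c * y, Or.inr (hQ.mul_mem_left (hQ.mul_mem_right hx hc) hy), mul_assoc _ _ _⟩
  pump_mem := by
    rintro _ ⟨x, hx, rfl⟩ h
    have hxc := hQ.mul_mem_right hx hc
    refine ⟨pump e (x * c) * (x * c) ^ (e - 1) * x, Or.inr (hQ.mul_mem_left (hQ.mul_mem_left
      (hQ.pump_mem _ hxc h) (hQ.pow_mem_insert (Or.inr hxc) _)) hx), ?_⟩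
    change pump e (x * c) * (x * c) ^ (e - 1) * x * c = pump e (x * c)
    rw [mul_assoc _ x c, mul_assoc _ _ (x * c), ← pow_succ, Nat.sub_add_cancel (by omega),
      pump_mul_pow he h (hp _)]

end IsPumpClosed

/-- The label of the product of the images of the letters of a word. -/
def label {B : Type*} (g : B → N × Set M) (w : List B) : N :=
  (w.map g).prod.1

theorem prod_map_joinBlocks {B P : Type*} [Monoid P] (g : B → P) (b : B) (us : List (List B)) :
    ((joinBlocks b us).map g).prod = (us.map fun u => (u.map g).prod * g b).prod := by
  induction us with
  | nil => rfl
  | cons u us ih => simp [ih, mul_assoc]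

/-- There is a finite colouring of the words over `S`, with colours in `insert 1 Q` and colour
classes in the star-free closure, such that the colour of `w` bounds `s` times the product of the
images of the letters of `w`. -/
def HasBound {B : Type*} (Q : Set (N × Set M)) (g : B → N × Set M) (S : Set B)
    (s : N × Set M) : Prop :=
  ∃ k : List B → N × Set M, (∀ y, InSF (recognized (label g)) (wordsOver S ⊓ {w | k w = y})) ∧
    ∀ w ∈ wordsOver S, k w ∈ insert 1 Q ∧ Below (s * (w.map g).prod) (k w)

/-- Every block is replaced by its colour under the first colouring. The resulting word of colours,
with the delimiter multiplied into each letter, is coloured by the second, and the unfinished last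
block contributes one more factor. -/
theorem HasBound.of_blocks [Finite N] [Finite M] {B : Type*} [Finite B] {e : ℕ}
    {Q Q' : Set (N × Set M)} (hQ : IsPumpClosed e Q) (hQ' : Q' ⊆ Q) {g : B → N × Set M}
    {S : Set B} {b : B} (hb : b ∈ S) (h1 : HasBound Q g (S \ {b}) 1)
    (h2 : HasBound Q' (fun y : N × Set M => y * g b) (insert 1 Q) 1) : HasBound Q g S 1 := by
  obtain ⟨k₁, hk₁, hk₁'⟩ := h1
  obtain ⟨k₂, hk₂, hk₂'⟩ := h2
  have hus : ∀ {us : List (List B)}, (∀ u ∈ us, u ∈ wordsOver (S \ {b})) →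
      us.map k₁ ∈ wordsOver (insert 1 Q) := by
    intro us hus y hy
    obtain ⟨u, hu, rfl⟩ := List.mem_map.1 hy
    exact (hk₁' u (hus u hu)).1
  have hbelow : ∀ {us : List (List B)}, (∀ u ∈ us, u ∈ wordsOver (S \ {b})) →
      Below ((joinBlocks b us).map g).prod (((us.map k₁).map fun y => y * g b).prod) := by
    intro us hus
    rw [prod_map_joinBlocks]
    induction us with
    | nil => exact Below.refl _
    | cons u us ih =>
      simp only [List.mem_cons, forall_eq_or_imp] at hus
      have := (hk₁' u hus.1).2
      rw [one_mul] at this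
      simpa using (this.mul (Below.refl (g b))).mul (ih hus.2)
  -- Uniqueness of the factorization makes the colour well defined; words not over `S` get the
  -- irrelevant value 1.
  have hk : ∀ w : List B, ∃ y : N × Set M, ∀ us u, (∀ u ∈ us, u ∈ wordsOver (S \ {b})) →
      u ∈ wordsOver (S \ {b}) → w = joinBlocks b us ++ u → y = k₂ (us.map k₁) * k₁ u := by
    intro w
    by_cases h : ∃ us u, (∀ u ∈ us, u ∈ wordsOver (S \ {b})) ∧ u ∈ wordsOver (S \ {b}) ∧
      w = joinBlocks b us ++ u
    · obtain ⟨us, u, hus, hu, rfl⟩ := h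
      refine ⟨k₂ (us.map k₁) * k₁ u, fun vs v hvs hv h => ?_⟩
      obtain ⟨rfl, rfl⟩ := joinBlocks_append_inj
        (fun u hu => notMem_of_mem_wordsOver_diff (hus u hu))
        (fun u hu => notMem_of_mem_wordsOver_diff (hvs u hu))
        (notMem_of_mem_wordsOver_diff hu) (notMem_of_mem_wordsOver_diff hv) h
      rfl
    · exact ⟨1, fun us u hus hu hw => absurd ⟨us, u, hus, hu, hw⟩ h⟩
  choose k hk using hk
  refine ⟨k, fun y => ?_, fun w hw => ?_⟩
  · have h : wordsOver S ⊓ ({w | k w = y} : Language B) =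
        {w | ∃ p ∈ {p : (N × Set M) × (N × Set M) | p.1 * p.2 = y},
          w ∈ blockPreimage b S k₁ (wordsOver (insert 1 Q) ⊓ {v | k₂ v = p.1}) *
            (wordsOver (S \ {b}) ⊓ {u | k₁ u = p.2})} := by
      ext w
      constructor
      · rintro ⟨hw, rfl⟩
        obtain ⟨us, u, hu1, hu2, rfl⟩ := exists_joinBlocks_append b hw
        exact ⟨(k₂ (us.map k₁), k₁ u), (hk _ us u hu1 hu2 rfl).symm, _,
          ⟨us, hu1, rfl, hus hu1, rfl⟩, u, ⟨hu2, rfl⟩, rfl⟩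
      · rintro ⟨p, hp, _, ⟨us, hu1, rfl, -, hp1⟩, u, ⟨hu2, hp2⟩, rfl⟩
        refine ⟨append_mem_wordsOver.2 ⟨joinBlocks_mem_wordsOver hb hu1,
          fun a ha => (hu2 a ha).1⟩, ?_⟩
        have hp1 : k₂ (us.map k₁) = p.1 := hp1
        have hp2 : k₁ u = p.2 := hp2
        exact (hk _ us u hu1 hu2 rfl).trans (by rw [hp1, hp2]; exact hp)
    rw [h]
    refine .biUnion (Set.toFinite _) (.recognized_bot _) fun p _ => .concat _ _ ?_ (hk₁ _)
    refine .blockPreimage (.recognized_bot _) (.recognized_top _) hb hk₁ ?_ (hk₂ _)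
    rintro _ ⟨F, rfl⟩
    -- Bounds preserve labels exactly, so the label of the word of colours equals the label of the
    -- word itself.
    have h : blockPreimage b S k₁ {w | label (fun y => y * g b) w ∈ F} =
        blockPreimage b S k₁ ⊤ ⊓ {w | label g w ∈ F} := by
      ext w
      constructor
      · rintro ⟨us, hu1, rfl, h⟩
        refine ⟨⟨us, hu1, rfl, trivial⟩, ?_⟩
        change _ ∈ F
        rwa [label, (hbelow hu1).1]
      · rintro ⟨⟨us, hu1, rfl, -⟩, h⟩
        refine ⟨us, hu1, rfl, ?_⟩
        change _ ∈ F
        rwa [label, ← (hbelow hu1).1]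
    rw [h, blockPreimage_top hb]
    exact .inter (.inter (.wordsOver (.recognized_bot _) (.recognized_top _) S)
      (.union _ _ (.nil (.recognized_bot _) (.recognized_top _))
        (.concat _ _ (.recognized_top _) (.letter b)))) (.base _ ⟨F, rfl⟩)
  · obtain ⟨us, u, hu1, hu2, rfl⟩ := exists_joinBlocks_append b hw
    rw [hk _ us u hu1 hu2 rfl]
    obtain ⟨h3, h4⟩ := hk₂' _ (hus hu1)
    obtain ⟨h5, h6⟩ := hk₁' u hu2
    rw [one_mul] at h4 h6
    refine ⟨hQ.mul_mem_insert (Set.insert_subset_insert hQ' h3) h5, ?_⟩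
    rw [one_mul, List.map_append, List.prod_append]
    exact ((hbelow hu1).trans h4).mul h6

/-- Letters act surjectively on the finite set of all `s * x`, so `e`-th powers of products act
trivially there. One element can then bound all products of a given label, and the colour need only
depend on the label. -/
theorem HasBound.of_surjective [Finite N] [Finite M] {B : Type*} [Finite B] {e : ℕ}
    (he : e ≠ 0) (hp : ∀ x : N × Set M, x ^ e * x ^ e = x ^ e) {Q : Set (N × Set M)}
    (hQ : IsPumpClosed e Q) {g : B → N × Set M} {S : Set B} (hg : ∀ b ∈ S, g b ∈ Q)
    {s : N × Set M} (hs : s ∈ insert 1 Q)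
    (hsurj : ∀ b ∈ S, ∀ x ∈ insert 1 Q, ∃ y ∈ insert 1 Q, s * x = s * y * g b) :
    HasBound Q g S s := by
  have hsurj' : ∀ w ∈ wordsOver S, ∀ x ∈ insert 1 Q, ∃ y ∈ insert 1 Q,
      s * x = s * y * (w.map g).prod := by
    intro w
    induction w with
    | nil => exact fun _ x hx => ⟨x, hx, by simp⟩
    | cons b w ih =>
      intro hw x hx
      rw [cons_mem_wordsOver] at hw
      obtain ⟨y, hy, hxy⟩ := ih hw.2 x hx
      obtain ⟨z, hz, hyz⟩ := hsurj b hw.1 y hy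
      exact ⟨z, hz, by rw [hxy, hyz, List.map_cons, List.prod_cons]; simp only [mul_assoc]⟩
  have hfix : ∀ w ∈ wordsOver S, ∀ x ∈ insert 1 Q, s * x * (w.map g).prod ^ e = s * x := by
    intro w hw x hx
    have : ∀ n : ℕ, ∀ x ∈ insert 1 Q, ∃ y ∈ insert 1 Q, s * x = s * y * (w.map g).prod ^ n := by
      intro n
      induction n with
      | zero => exact fun x hx => ⟨x, hx, by simp⟩
      | succ n ih =>
        intro x hx
        obtain ⟨y, hy, hxy⟩ := hsurj' w hw x hx
        obtain ⟨z, hz, hyz⟩ := ih y hy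
        exact ⟨z, hz, by rw [hxy, hyz, pow_succ, mul_assoc]⟩
    obtain ⟨y, -, hy⟩ := this e x hx
    rw [hy, mul_assoc, hp]
  -- The common bound is a product of pumped elements. Each pumped factor lies above both an `e`-th
  -- power, which acts trivially, and an `(e + 1)`-st power, which acts as the element itself.
  have hjoin : ∀ V : Set (N × Set M), V.Finite →
      (∀ x ∈ V, x.1 * x.1 = x.1 ∧ ∃ w ∈ wordsOver S, (w.map g).prod = x) →
      ∃ y ∈ insert 1 Q, Below s (s * y) ∧ ∀ x ∈ V, Below (s * x) (s * y) := by
    intro V hV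
    induction V, hV using Set.Finite.induction_on with
    | empty => exact fun _ => ⟨1, Or.inl rfl, by rw [mul_one]; exact Below.refl _, by simp⟩
    | @insert a V _ _ ih =>
      intro h
      obtain ⟨y, hy, hsy, hV⟩ := ih fun x hx => h x (Or.inr hx)
      obtain ⟨ha, w, hw, rfl⟩ := h a (Or.inl rfl)
      have hb := below_pump he ha
      refine ⟨y * pump e (w.map g).prod,
        hQ.mul_mem_insert hy (hQ.pump_mem_insert (hQ.prod_mem_insert hg hw) ha), ?_, ?_⟩
      · have := hsy.mul hb
        have h1 := hfix w hw 1 (Or.inl rfl)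
        rw [mul_one] at h1
        rwa [h1, mul_assoc] at this
      · rintro x (rfl | hx)
        · have h1 := hfix w hw 1 (Or.inl rfl)
          rw [mul_one] at h1
          have := hsy.mul (below_pump_succ e ha)
          rwa [pow_succ, ← mul_assoc, h1, mul_assoc] at this
        · obtain ⟨-, v, hv, rfl⟩ := h x (Or.inr hx)
          have := (hV _ hx).mul hb
          rwa [hfix w hw _ (hQ.prod_mem_insert hg hv), mul_assoc] at this
  have hbound : ∀ n : N, ∃ y ∈ insert 1 Q, ∀ w ∈ wordsOver S, label g w = n →
      Below (s * (w.map g).prod) y := by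
    intro n
    by_cases hn : ∃ c ∈ wordsOver S, label g c = n
    · obtain ⟨c, hc, rfl⟩ := hn
      obtain ⟨y, hy, -, hV⟩ := hjoin {x | x.1 * x.1 = x.1 ∧ ∃ w ∈ wordsOver S, (w.map g).prod = x}
        (Set.toFinite _) fun x hx => hx
      have hcp := hQ.prod_mem_insert hg hc
      refine ⟨s * y * (c.map g).prod, hQ.mul_mem_insert (hQ.mul_mem_insert hs hy) hcp,
        fun w hw hwc => ?_⟩
      -- Appending `e - 1` copies of `c` to a word with the label of `c` produces an idempotent
      -- label, to which `hjoin` applies. One more factor `c` completes a power that acts trivially.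
      have hpow : ∀ m : ℕ, ∃ v ∈ wordsOver S, (v.map g).prod = (w.map g).prod * (c.map g).prod ^ m := by
        intro m
        induction m with
        | zero => exact ⟨w, hw, by simp⟩
        | succ m ih =>
          obtain ⟨v, hv, h⟩ := ih
          exact ⟨v ++ c, append_mem_wordsOver.2 ⟨hv, hc⟩, by simp [h, pow_succ, mul_assoc]⟩
      have h1 : ((w.map g).prod * (c.map g).prod ^ (e - 1)).1 = ((c.map g).prod ^ e).1 := by
        have : ((w.map g).prod).1 = ((c.map g).prod).1 := hwc
        rw [Prod.fst_mul, this, ← Prod.fst_mul, ← pow_succ', Nat.sub_add_cancel (by omega)]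
      have h2 := hV ((w.map g).prod * (c.map g).prod ^ (e - 1))
        ⟨by rw [h1, ← Prod.fst_mul, hp], hpow _⟩
      have h3 := h2.mul (Below.refl (c.map g).prod)
      rwa [← mul_assoc, mul_assoc _ _ (c.map g).prod, ← pow_succ, Nat.sub_add_cancel (by omega),
        hfix c hc _ (hQ.prod_mem_insert hg hw)] at h3
    · exact ⟨1, Or.inl rfl, fun w hw h => absurd ⟨w, hw, h⟩ hn⟩
  choose y hy hy' using hbound
  refine ⟨fun w => y (label g w), fun z => ?_, fun w hw => ⟨hy _, hy' _ w hw rfl⟩⟩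
  exact .inter (.wordsOver (.recognized_bot _) (.recognized_top _) S) (.base _ ⟨{n | y n = z}, rfl⟩)

/-- Induction on the size of the orbit `s * insert 1 Q`. If `s` returns to itself under some element
of `Q`, the letters act surjectively on the orbit. Otherwise the first letter is absorbed into `s`,
which shrinks the orbit. -/
theorem HasBound.of_image_mul_eq [Finite N] [Finite M] {B : Type*} [Finite B] {e : ℕ}
    (he : e ≠ 0) (hp : ∀ x : N × Set M, x ^ e * x ^ e = x ^ e) {Q : Set (N × Set M)}
    (hQ : IsPumpClosed e Q) {g : B → N × Set M} {S : Set B} (hg : ∀ b ∈ S, g b ∈ Q)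
    (himg : ∀ b ∈ S, (· * g b) '' insert 1 Q = Q) {s : N × Set M} (hs : s ∈ insert 1 Q) :
    HasBound Q g S s := by
  induction h : ((s * ·) '' insert 1 Q).ncard using Nat.strong_induction_on generalizing s with
  | _ n ih =>
    by_cases hsQ : s ∈ (s * ·) '' Q
    · refine .of_surjective he hp hQ hg hs fun b hb x hx => ?_
      obtain ⟨z, hz, hxz⟩ : ∃ z ∈ Q, s * x = s * z := by
        rcases hx with rfl | hx
        · obtain ⟨z, hz, hz'⟩ := hsQ
          exact ⟨z, hz, by rw [mul_one]; exact hz'.symm⟩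
        · exact ⟨x, hx, rfl⟩
      rw [← himg b hb] at hz
      obtain ⟨y, hy, rfl⟩ := hz
      exact ⟨y, hy, by rw [hxz, mul_assoc]⟩
    · have hrec : ∀ b : B, ∃ k : List B → N × Set M, b ∈ S →
          (∀ y, InSF (recognized (label g)) (wordsOver S ⊓ {w | k w = y})) ∧
          ∀ w ∈ wordsOver S, k w ∈ insert 1 Q ∧ Below (s * g b * (w.map g).prod) (k w) := by
        intro b
        by_cases hb : b ∈ S
        · have hlt : ((s * g b * ·) '' insert 1 Q).ncard < n := by
            rw [← h]
            -- The new orbit omits `s`, which would otherwise be a multiple of itself by an element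
            -- of `Q`.
            refine Set.ncard_lt_ncard ⟨?_, fun hss => hsQ ?_⟩ (Set.toFinite _)
            · rintro _ ⟨x, hx, rfl⟩
              exact ⟨g b * x, Or.inr (hQ.mul_mem_left (hg b hb) hx), (mul_assoc _ _ _).symm⟩
            · obtain ⟨x, hx, hxs⟩ := hss ⟨1, Or.inl rfl, mul_one s⟩
              exact ⟨g b * x, hQ.mul_mem_left (hg b hb) hx, (mul_assoc _ _ _).symm.trans hxs⟩
          obtain ⟨k, hk⟩ := ih _ hlt (hQ.mul_mem_insert hs (Or.inr (hg b hb))) rfl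
          exact ⟨k, fun _ => hk⟩
        · exact ⟨fun _ => 1, fun h => absurd h hb⟩
      choose k hk using hrec
      refine ⟨fun w => w.casesOn s fun b u => k b u, fun y => ?_, fun w hw => ?_⟩
      · have hcons : InSF (recognized (label g))
            {w | ∃ b ∈ S, w ∈ ({[b]} : Language B) * (wordsOver S ⊓ {w | k b w = y})} :=
          .biUnion (Set.toFinite _) (.recognized_bot _)
            fun b hb => .concat _ _ (.letter b) ((hk b hb).1 y)
        have hnil : InSF (recognized (label g)) ({[]} ⊓ {w | s = y}) := by
          refine .inter (.nil (.recognized_bot _) (.recognized_top _)) (.base _ ⟨{n | s = y}, rfl⟩)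
        convert InSF.union _ _ hcons hnil using 1
        ext w
        constructor
        · rintro ⟨hw, h⟩
          cases w with
          | nil => exact Or.inr ⟨rfl, h⟩
          | cons b u =>
            have hw := cons_mem_wordsOver.1 hw
            exact Or.inl ⟨b, hw.1, [b], rfl, u, ⟨hw.2, h⟩, rfl⟩
        · rintro (⟨b, hb, _, rfl, u, ⟨hu, h⟩, rfl⟩ | ⟨rfl, h⟩)
          · exact ⟨cons_mem_wordsOver.2 ⟨hb, hu⟩, h⟩
          · exact ⟨nil_mem_wordsOver, h⟩
      · cases w with
        | nil => exact ⟨hs, by rw [List.map_nil, List.prod_nil, mul_one]; exact Below.refl _⟩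
        | cons b u =>
          rw [cons_mem_wordsOver] at hw
          have := (hk b hw.1).2 u hw.2
          rwa [mul_assoc] at this

end LabelledSets

/-- The induction on `Q` varies the alphabet, which becomes `N × Set M` itself after the passage to
blocks; hence the common universe. The inner induction removes the delimiter from `S`. -/
theorem hasBound {N M B : Type u} [Monoid N] [Monoid M] [Finite N] [Finite M] [Finite B] {e : ℕ}
    (he : e ≠ 0) (hp : ∀ x : N × Set M, x ^ e * x ^ e = x ^ e) {Q : Set (N × Set M)}
    (hQ : IsPumpClosed e Q) {g : B → N × Set M} {S : Set B} (hg : ∀ b ∈ S, g b ∈ Q) :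
    HasBound Q g S 1 := by
  induction hn : Q.ncard using Nat.strong_induction_on generalizing Q B with
  | _ n ihQ =>
    induction hm : S.ncard using Nat.strong_induction_on generalizing S with
    | _ m ihS =>
      by_cases hall : ∀ b ∈ S, (· * g b) '' insert 1 Q = Q
      · exact .of_image_mul_eq he hp hQ hg hall (Or.inl rfl)
      · push Not at hall
        obtain ⟨b, hb, hne⟩ := hall
        have hsub := hQ.image_mul_subset (hg b hb)
        refine .of_blocks hQ hsub hb (ihS _ ?_ (fun a ha => hg a ha.1) rfl)
          (ihQ _ ?_ (hQ.image_mul he hp (hg b hb)) (fun y hy => ⟨y, hy, rfl⟩) rfl)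
        · rw [← hm]
          exact Set.ncard_sdiff_singleton_lt_of_mem hb (Set.toFinite _)
        · rw [← hn]
          exact Set.ncard_lt_ncard (hsub.ssubset_of_ne hne) (Set.toFinite _)

/-! ### Powers of words and aperiodicity relative to `η`. -/

section Powers

variable {A : Type*}

/-- The concatenation of `n` copies of the word `u`. -/
def wordPow (u : List A) (n : ℕ) : List A :=
  (List.replicate n u).flatten

theorem wordPow_zero (u : List A) : wordPow u 0 = [] := rfl

theorem wordPow_succ (u : List A) (n : ℕ) : wordPow u (n + 1) = u ++ wordPow u n := by
  simp [wordPow, List.replicate_succ]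

theorem wordPow_succ' (u : List A) (n : ℕ) : wordPow u (n + 1) = wordPow u n ++ u := by
  simp [wordPow, List.replicate_succ']

theorem wordPow_add (u : List A) (m n : ℕ) : wordPow u (m + n) = wordPow u m ++ wordPow u n := by
  rw [wordPow, List.replicate_add, List.flatten_append, wordPow, wordPow]

theorem wordPow_append {i j n : ℕ} (s t : List A) (h : i + j + 1 = n) :
    wordPow (s ++ t) n = wordPow (s ++ t) i ++ s ++ (t ++ wordPow (s ++ t) j) := by
  rw [← h, add_assoc, wordPow_add, wordPow_succ]
  simp

theorem length_wordPow (u : List A) (n : ℕ) : (wordPow u n).length = n * u.length := by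
  simp [wordPow]

theorem append_wordPow_append_eq {u : List A} {n : ℕ} {x y p q : List A}
    (h : x ++ wordPow u n ++ y = p ++ q) :
    (∃ t, x = p ++ t ∧ q = t ++ wordPow u n ++ y) ∨
    (∃ s, y = s ++ q ∧ p = x ++ wordPow u n ++ s) ∨
    ∃ i j s t, i + j + 1 = n ∧ s ++ t = u ∧ p = x ++ wordPow u i ++ s ∧
      q = t ++ wordPow u j ++ y := by
  induction n generalizing x with
  | zero =>
    simp only [wordPow_zero, List.append_nil] at h ⊢
    rcases List.append_eq_append_iff.1 h with ⟨s, rfl, rfl⟩ | ⟨t, rfl, rfl⟩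
    · exact Or.inr (Or.inl ⟨s, rfl, rfl⟩)
    · exact Or.inl ⟨t, rfl, rfl⟩
  | succ n ih =>
    rw [wordPow_succ, ← List.append_assoc] at h
    rcases ih h with ⟨t, ht, rfl⟩ | ⟨s, rfl, rfl⟩ | ⟨i, j, s, t, hij, hst, rfl, rfl⟩
    · rcases List.append_eq_append_iff.1 ht with ⟨s, rfl, rfl⟩ | ⟨t', rfl, rfl⟩
      · exact Or.inr (Or.inr ⟨0, n, s, t, by omega, rfl, by simp [wordPow_zero], rfl⟩)
      · exact Or.inl ⟨t', rfl, by simp [wordPow_succ]⟩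
    · exact Or.inr (Or.inl ⟨s, rfl, by simp [wordPow_succ]⟩)
    · exact Or.inr (Or.inr ⟨i + 1, j, s, t, by omega, hst, by simp [wordPow_succ], rfl⟩)

variable {N : Type*} [Monoid N] {η : List A → N}

theorem map_wordPow (h1 : η [] = 1) (hη : ∀ u v, η (u ++ v) = η u * η v) (u : List A) (n : ℕ) :
    η (wordPow u n) = η u ^ n := by
  induction n with
  | zero => rw [wordPow_zero, h1, pow_zero]
  | succ n ih => rw [wordPow_succ, hη, ih, pow_succ']

/-- Sufficiently high powers of words whose image under `η` is idempotent cannot be counted by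
a language of the star-free closure. -/
theorem InSF.exists_wordPow_iff {C : Set (Language A)} (h1 : η [] = 1)
    (hη : ∀ u v, η (u ++ v) = η u * η v) (hC : C ⊆ recognized η) {L : Language A}
    (hL : InSF C L) : ∃ k, ∀ n ≥ k, ∀ u, η u * η u = η u → ∀ x y,
      x ++ wordPow u n ++ y ∈ L ↔ x ++ wordPow u (n + 1) ++ y ∈ L := by
  induction hL with
  | base L hL =>
    obtain ⟨F, rfl⟩ := hC hL
    refine ⟨1, fun n hn u hu x y => ?_⟩
    change η _ ∈ F ↔ η _ ∈ F
    simp only [hη, map_wordPow h1 hη]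
    rw [pow_eq_self_of_mul_self hu (by omega), pow_eq_self_of_mul_self hu (by omega)]
  | letter a =>
    refine ⟨2, fun n hn u _ x y => ?_⟩
    rcases eq_or_ne u [] with rfl | hu
    · simp [wordPow]
    · have key : ∀ m ≥ 2, x ++ wordPow u m ++ y ∉ ({[a]} : Language A) := by
        intro m hm h
        have h := congrArg List.length (show _ = [a] from h)
        simp only [List.length_append, length_wordPow, List.length_singleton] at h
        have := List.length_pos_iff.2 hu
        nlinarith
      exact iff_of_false (key n hn) (key _ (by omega))
  | union K L _ _ hK hL =>
    obtain ⟨k, hk⟩ := hK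
    obtain ⟨l, hl⟩ := hL
    exact ⟨max k l, fun n hn u hu x y => or_congr (hk n (by omega) u hu x y)
      (hl n (by omega) u hu x y)⟩
  | compl K _ hK =>
    obtain ⟨k, hk⟩ := hK
    exact ⟨k, fun n hn u hu x y => not_congr (hk n hn u hu x y)⟩
  | concat K L _ _ hK hL =>
    obtain ⟨k, hk⟩ := hK
    obtain ⟨l, hl⟩ := hL
    -- A cut inside one copy of `u = s ++ t` leaves `n - 1` whole copies, so one side has enough for
    -- its threshold. There the copy is added between `x` and `s`, or between `t` and `y`.
    refine ⟨k + l + 1, fun n hn u hu x y => ⟨?_, ?_⟩⟩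
    · rintro ⟨p, hp, q, hq, hpq⟩
      rcases append_wordPow_append_eq hpq.symm with
        ⟨t, rfl, rfl⟩ | ⟨s, rfl, rfl⟩ | ⟨i, j, s, t, hij, rfl, rfl, rfl⟩
      · exact ⟨p, hp, _, (hl n (by omega) u hu t y).1 hq, by simp⟩
      · exact ⟨_, (hk n (by omega) u hu x s).1 hp, q, hq, by simp⟩
      · rcases (by omega : k ≤ i ∨ l ≤ j) with h | h
        · refine ⟨_, (hk i h _ hu x s).1 hp, _, hq, ?_⟩
          rw [wordPow_append s t (show (i + 1) + j + 1 = n + 1 by omega)]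
          simp
        · refine ⟨_, hp, _, (hl j h _ hu t y).1 hq, ?_⟩
          rw [wordPow_append s t (show i + (j + 1) + 1 = n + 1 by omega)]
          simp
    · rintro ⟨p, hp, q, hq, hpq⟩
      rcases append_wordPow_append_eq hpq.symm with
        ⟨t, rfl, rfl⟩ | ⟨s, rfl, rfl⟩ | ⟨i, j, s, t, hij, rfl, rfl, rfl⟩
      · exact ⟨p, hp, _, (hl n (by omega) u hu t y).2 hq, by simp⟩
      · exact ⟨_, (hk n (by omega) u hu x s).2 hp, q, hq, by simp⟩
      · rcases (by omega : k + 1 ≤ i ∨ l + 1 ≤ j) with h | h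
        · obtain ⟨i, rfl⟩ : ∃ i', i = i' + 1 := ⟨i - 1, by omega⟩
          refine ⟨_, (hk i (by omega) _ hu x s).2 hp, _, hq, ?_⟩
          rw [wordPow_append s t (show i + j + 1 = n by omega)]
          simp
        · obtain ⟨j, rfl⟩ : ∃ j', j = j' + 1 := ⟨j - 1, by omega⟩
          refine ⟨_, hp, _, (hl j (by omega) _ hu t y).2 hq, ?_⟩
          rw [wordPow_append s t (show i + j + 1 = n by omega)]
          simp

end Powers

/-- The least set of labelled sets that contains the images of the letters and is closed under
multiplication and pumping. -/
inductive PumpClosure {A N M : Type*} [Monoid N] [Monoid M] (e : ℕ) (g : A → N × Set M) :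
    N × Set M → Prop
  | letter (a : A) : PumpClosure e g (g a)
  | mul (x y : N × Set M) : PumpClosure e g x → PumpClosure e g y → PumpClosure e g (x * y)
  | pump (x : N × Set M) : PumpClosure e g x → x.1 * x.1 = x.1 → PumpClosure e g (pump e x)

theorem isPumpClosed_pumpClosure {A N M : Type*} [Monoid N] [Monoid M] (e : ℕ)
    (g : A → N × Set M) : IsPumpClosed e {x | PumpClosure e g x} :=
  ⟨fun x hx y hy => .mul x y hx hy, fun x hx h => .pump x hx h⟩

/-! ### Elements of the closure are realized by indistinguishable words. -/

section Soundness

variable {A : Type*}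

/-- Two words are equivalent if no language of `Ks` distinguishes them in any context. -/
def ContextEquiv (Ks : Set (Language A)) (u v : List A) : Prop :=
  ∀ K ∈ Ks, ∀ x y, x ++ u ++ y ∈ K ↔ x ++ v ++ y ∈ K

theorem ContextEquiv.refl (Ks : Set (Language A)) (u : List A) : ContextEquiv Ks u u :=
  fun _ _ _ _ => Iff.rfl

theorem ContextEquiv.symm {Ks : Set (Language A)} {u v : List A} (h : ContextEquiv Ks u v) :
    ContextEquiv Ks v u :=
  fun K hK x y => (h K hK x y).symm

theorem ContextEquiv.trans {Ks : Set (Language A)} {u v w : List A} (h : ContextEquiv Ks u v)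
    (h' : ContextEquiv Ks v w) : ContextEquiv Ks u w :=
  fun K hK x y => (h K hK x y).trans (h' K hK x y)

theorem ContextEquiv.append {Ks : Set (Language A)} {u v u' v' : List A}
    (h : ContextEquiv Ks u v) (h' : ContextEquiv Ks u' v') :
    ContextEquiv Ks (u ++ u') (v ++ v') := by
  intro K hK x y
  have h1 := h K hK x (u' ++ y)
  have h2 := h' K hK (x ++ v) y
  simp only [List.append_assoc] at h1 h2 ⊢
  exact h1.trans h2

variable {N M : Type*} [Monoid N] [Monoid M]

/-- Every element of the labelled set `x` is the image of a word which has the same label as `v`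
and is equivalent to `v`. -/
def RealizedBy (Ks : Set (Language A)) (η : List A → N) (α : List A → M) (x : N × Set M)
    (v : List A) : Prop :=
  η v = x.1 ∧ ∀ t ∈ x.2, ∃ w, α w = t ∧ η w = x.1 ∧ ContextEquiv Ks w v

variable {Ks : Set (Language A)} {η : List A → N} {α : List A → M}

theorem RealizedBy.nil (h1 : η [] = 1) (h1' : α [] = 1) : RealizedBy Ks η α 1 [] := by
  refine ⟨h1, fun t ht => ⟨[], ?_, h1, .refl _ _⟩⟩
  rw [h1', Set.mem_one.1 ht]

theorem RealizedBy.mul (hη : ∀ u v, η (u ++ v) = η u * η v) (hα : ∀ u v, α (u ++ v) = α u * α v)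
    {x y : N × Set M} {u v : List A} (hx : RealizedBy Ks η α x u) (hy : RealizedBy Ks η α y v) :
    RealizedBy Ks η α (x * y) (u ++ v) := by
  refine ⟨by rw [hη, hx.1, hy.1, Prod.fst_mul], fun t ht => ?_⟩
  obtain ⟨t₁, ht₁, t₂, ht₂, rfl⟩ := Set.mem_mul.1 ht
  obtain ⟨w₁, rfl, h₁, e₁⟩ := hx.2 t₁ ht₁
  obtain ⟨w₂, rfl, h₂, e₂⟩ := hy.2 t₂ ht₂
  exact ⟨w₁ ++ w₂, hα _ _, by rw [hη, h₁, h₂, Prod.fst_mul], e₁.append e₂⟩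

theorem RealizedBy.pow (h1 : η [] = 1) (h1' : α [] = 1) (hη : ∀ u v, η (u ++ v) = η u * η v)
    (hα : ∀ u v, α (u ++ v) = α u * α v) {x : N × Set M} {u : List A}
    (hx : RealizedBy Ks η α x u) (n : ℕ) : RealizedBy Ks η α (x ^ n) (wordPow u n) := by
  induction n with
  | zero => rw [pow_zero]; exact .nil h1 h1'
  | succ n ih => rw [pow_succ, wordPow_succ']; exact .mul hη hα ih hx

theorem RealizedBy.pump (h1 : η [] = 1) (h1' : α [] = 1) (hη : ∀ u v, η (u ++ v) = η u * η v)
    (hα : ∀ u v, α (u ++ v) = α u * α v) {e : ℕ} (he : e ≠ 0)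
    (hp : ∀ x : N × Set M, x ^ e * x ^ e = x ^ e) {k : ℕ}
    (hk : ∀ n ≥ k, ∀ u, η u * η u = η u → ContextEquiv Ks (wordPow u n) (wordPow u (n + 1)))
    {x : N × Set M} (hx1 : x.1 * x.1 = x.1) {u : List A} (hx : RealizedBy Ks η α x u) :
    RealizedBy Ks η α (pump e x) (wordPow u (e * (k + 1))) := by
  -- The exponent is a multiple of `e`, which preserves the power of `x`, and is at least `k`, so
  -- that one further copy of `u` goes unnoticed by `Ks`.
  have hpow : x ^ e = x ^ (e * (k + 1)) := by
    rw [pow_mul, pow_eq_self_of_mul_self (hp x) k.succ_ne_zero]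
  have hpow' : x ^ (e + 1) = x ^ (e * (k + 1) + 1) := by rw [pow_succ, pow_succ, ← hpow]
  have hr := hx.pow h1 h1' hη hα (e * (k + 1))
  have hr' := hx.pow h1 h1' hη hα (e * (k + 1) + 1)
  rw [← hpow] at hr
  rw [← hpow'] at hr'
  have h2 : (x ^ e).1 = x.1 := pow_eq_self_of_mul_self hx1 he
  have h3 : (x ^ (e + 1)).1 = x.1 := pow_eq_self_of_mul_self hx1 e.succ_ne_zero
  refine ⟨hr.1.trans h2, ?_⟩
  rintro t (ht | ht)
  · obtain ⟨w, hw, hw1, hw2⟩ := hr.2 t ht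
    exact ⟨w, hw, hw1.trans h2, hw2⟩
  · obtain ⟨w, hw, hw1, hw2⟩ := hr'.2 t ht
    refine ⟨w, hw, hw1.trans h3, hw2.trans (ContextEquiv.symm (hk _ ?_ u ?_))⟩
    · have := Nat.mul_le_mul_right (k + 1) (Nat.one_le_iff_ne_zero.2 he)
      omega
    · rw [hx.1, hx1]

theorem PumpClosure.exists_realizedBy {C : Set (Language A)} (h1 : η [] = 1) (h1' : α [] = 1)
    (hη : ∀ u v, η (u ++ v) = η u * η v) (hα : ∀ u v, α (u ++ v) = α u * α v)
    (hC : C ⊆ recognized η) (hfin : Ks.Finite) (hKs : Ks ⊆ SF C) {e : ℕ} (he : e ≠ 0)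
    (hp : ∀ x : N × Set M, x ^ e * x ^ e = x ^ e) {x : N × Set M}
    (hx : PumpClosure e (fun a => (η [a], {α [a]})) x) : ∃ v, RealizedBy Ks η α x v := by
  have hk : ∃ k, ∀ n ≥ k, ∀ u, η u * η u = η u →
      ContextEquiv Ks (wordPow u n) (wordPow u (n + 1)) := by
    have : ∀ K : Language A, ∃ k, K ∈ Ks → ∀ n ≥ k, ∀ u, η u * η u = η u → ∀ x y,
        x ++ wordPow u n ++ y ∈ K ↔ x ++ wordPow u (n + 1) ++ y ∈ K := by
      intro K
      by_cases hK : K ∈ Ks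
      · obtain ⟨k, hk⟩ := (hKs hK).exists_wordPow_iff h1 hη hC
        exact ⟨k, fun _ => hk⟩
      · exact ⟨0, fun h => absurd h hK⟩
    choose f hf using this
    obtain ⟨k, hk⟩ := (hfin.image f).bddAbove
    exact ⟨k, fun n hn u hu K hK => hf K hK n ((hk ⟨K, hK, rfl⟩).trans hn) u hu⟩
  obtain ⟨k, hk⟩ := hk
  induction hx with
  | letter a =>
    refine ⟨[a], rfl, fun t ht => ⟨[a], ht.symm, rfl, .refl _ _⟩⟩
  | mul x y _ _ hx hy =>
    obtain ⟨u, hu⟩ := hx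
    obtain ⟨v, hv⟩ := hy
    exact ⟨_, .mul hη hα hu hv⟩
  | pump x _ hx1 hx =>
    obtain ⟨u, hu⟩ := hx
    exact ⟨_, .pump h1 h1' hη hα he hp hk hx1 hu⟩

end Soundness

theorem InSF.trans {A : Type*} {C C' : Set (Language A)} (h : C' ⊆ SF C) {L : Language A}
    (hL : InSF C' L) : InSF C L := by
  induction hL with
  | base L hL => exact h hL
  | letter a => exact .letter a
  | union K L _ _ hK hL => exact .union K L hK hL
  | compl K _ hK => exact .compl K hK
  | concat K L _ _ hK hL => exact .concat K L hK hL

/-- Given an obstruction, the language of a cover that contains the realizing word from `L₁` also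
contains one from every `L ∈ Ls`. Without one, the colour classes of `hasBound` give the cover. -/
theorem coverable_iff {A N M : Type u} [Finite A] [Finite N] [Finite M] [Monoid N] [Monoid M]
    {η : List A → N} {α : List A → M} (h1 : η [] = 1) (h1' : α [] = 1)
    (hη : ∀ u v, η (u ++ v) = η u * η v) (hα : ∀ u v, α (u ++ v) = α u * α v)
    {C : Set (Language A)} (hC : C ⊆ recognized η) (hC' : recognized η ⊆ SF C) {e : ℕ}
    (he : e ≠ 0) (hp : ∀ x : N × Set M, x ^ e * x ^ e = x ^ e) {L₁ : Language A}
    {Ls : Set (Language A)} (hL₁ : L₁ ∈ recognized α) (hLs : Ls ⊆ recognized α) :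
    Coverable (SF C) L₁ Ls ↔
      ¬ ∃ x, (x = 1 ∨ PumpClosure e (fun a => (η [a], ({α [a]} : Set M))) x) ∧
        (∃ w ∈ L₁, α w ∈ x.2) ∧ ∀ L ∈ Ls, ∃ w ∈ L, α w ∈ x.2 := by
  constructor
  · rintro ⟨Ks, ⟨hfin, hcov⟩, hKs, hsep⟩ ⟨x, hx, ⟨w, hw, hwx⟩, hLsx⟩
    obtain ⟨v, hv⟩ : ∃ v, RealizedBy Ks η α x v := by
      rcases hx with rfl | hx
      · exact ⟨_, .nil h1 h1'⟩
      · exact hx.exists_realizedBy h1 h1' hη hα hC hfin hKs he hp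
    obtain ⟨F, rfl⟩ := hL₁
    obtain ⟨w₁, hw₁, -, e₁⟩ := hv.2 _ hwx
    obtain ⟨K, hK, hwK⟩ := hcov w₁ (show α w₁ ∈ F by rw [hw₁]; exact hw)
    obtain ⟨L, hL, hKL⟩ := hsep K hK
    obtain ⟨w', hw', hwx'⟩ := hLsx L hL
    obtain ⟨F', rfl⟩ := hLs hL
    obtain ⟨w₂, hw₂, -, e₂⟩ := hv.2 _ hwx'
    have h3 := (e₁.trans e₂.symm) K hK [] []
    simp only [List.nil_append, List.append_nil] at h3
    have h4 : w₂ ∈ K ⊓ {w | α w ∈ F'} :=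
      ⟨h3.1 hwK, show α w₂ ∈ F' by rw [hw₂]; exact hw'⟩
    rw [hKL] at h4
    exact h4
  · intro h
    set g : A → N × Set M := fun a => (η [a], {α [a]}) with hg
    have hprod : ∀ w, (w.map g).prod = (η w, {α w}) := by
      intro w
      induction w with
      | nil => rw [h1, h1']; rfl
      | cons a w ih =>
        rw [List.map_cons, List.prod_cons, ih, ← List.singleton_append, hη, hα]
        simp [hg]
    have hlabel : label g = η := funext fun w => congrArg Prod.fst (hprod w)
    obtain ⟨k, hk, hk'⟩ := hasBound he hp (isPumpClosed_pumpClosure e g) (S := Set.univ)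
      fun a _ => PumpClosure.letter a
    have huniv : ∀ w : List A, w ∈ wordsOver Set.univ := fun w a _ => trivial
    -- Only colours that meet the image of `L₁` are kept; each must then miss the image of some `L ∈
    -- Ls`.
    refine ⟨(fun y => wordsOver Set.univ ⊓ {w | k w = y}) '' {y | (y = 1 ∨ PumpClosure e g y) ∧
      ∃ w ∈ L₁, α w ∈ y.2}, ⟨(Set.toFinite _).image _, fun w hw => ?_⟩, ?_, ?_⟩
    · obtain ⟨hkw, hb⟩ := hk' w (huniv w)
      rw [one_mul, hprod] at hb
      exact ⟨_, ⟨k w, ⟨hkw, w, hw, hb.2 rfl⟩, rfl⟩, huniv w, rfl⟩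
    · rintro _ ⟨y, -, rfl⟩
      have := hk y
      rw [hlabel] at this
      exact this.trans hC'
    · rintro _ ⟨y, ⟨hy, hyL⟩, rfl⟩
      by_contra hcon
      refine h ⟨y, hy, hyL, fun L hL => ?_⟩
      by_contra hno
      refine hcon ⟨L, hL, Set.eq_empty_of_forall_notMem ?_⟩
      rintro w ⟨⟨-, hw⟩, hwL⟩
      obtain ⟨-, hb⟩ := hk' w (huniv w)
      have hw : k w = y := hw
      rw [one_mul, hprod, hw] at hb
      exact hno ⟨w, hwL, hb.2 rfl⟩

/-- Among the powers up to `k` two coincide; their distance, a period, divides `k!`, and `k!` lies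
beyond the preperiod. -/
theorem pow_factorial_mul_self {P : Type*} [Monoid P] [Finite P] {k : ℕ} (hk : Nat.card P ≤ k)
    (x : P) : x ^ k.factorial * x ^ k.factorial = x ^ k.factorial := by
  have : Fintype P := Fintype.ofFinite P
  obtain ⟨i, j, hij, hx⟩ : ∃ i j : ℕ, i < j ∧ j ≤ k ∧ x ^ i = x ^ j := by
    obtain ⟨a, b, hab, h⟩ := Fintype.exists_ne_map_eq_of_card_lt (fun i : Fin (k + 1) => x ^ (i : ℕ))
      (by rw [Fintype.card_fin, ← Nat.card_eq_fintype_card]; omega)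
    rcases lt_or_gt_of_ne hab with h' | h'
    · exact ⟨a, b, h', by omega, h⟩
    · exact ⟨b, a, h', by omega, h.symm⟩
  obtain ⟨hjk, hx⟩ := hx
  obtain ⟨q, hq⟩ : j - i ∣ k.factorial := Nat.dvd_factorial (by omega) (by omega)
  have hper : ∀ q : ℕ, x ^ (i + (j - i) * q) = x ^ i := by
    intro q
    induction q with
    | zero => simp
    | succ q ih =>
      rw [Nat.mul_succ, ← add_assoc, pow_add, ih, ← pow_add, Nat.add_sub_cancel' hij.le, hx]
  have hi : i ≤ k.factorial := (hij.le.trans hjk).trans k.self_le_factorial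
  have h1 := hper q
  rw [← hq] at h1
  calc x ^ k.factorial * x ^ k.factorial
      = x ^ (k.factorial - i) * x ^ (i + k.factorial) := by
        rw [← pow_add, ← pow_add]
        congr 1
        omega
    _ = x ^ k.factorial := by rw [h1, ← pow_add, Nat.sub_add_cancel hi]

/-! ### Computing the closure with lists of words. -/

section Saturation

variable {A N M : Type*} [Monoid N] [Monoid M]

/-- The product of two labelled lists of words. -/
def listMul (x y : N × List (List A)) : N × List (List A) :=
  (x.1 * y.1, x.2.flatMap fun u => y.2.map fun v => u ++ v)

/-- The powers of a labelled list of words. -/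
def listPow (x : N × List (List A)) (n : ℕ) : N × List (List A) :=
  (listMul x)^[n] (1, [[]])

/-- The counterpart of `pump` for labelled lists of words. -/
def listPump (e : ℕ) (x : N × List (List A)) : N × List (List A) :=
  (x.1, (listPow x e).2 ++ (listPow x (e + 1)).2)

/-- One round of the saturation procedure: all products and all pumped elements are added. -/
def saturateStep [DecidableEq N] (e : ℕ) (F : List (N × List (List A))) :
    List (N × List (List A)) :=
  F ++ ((F.flatMap fun x => F.map fun y => listMul x y) ++
    (F.filter fun x => x.1 * x.1 = x.1).map (listPump e))

/-- The result of `n` rounds of the saturation procedure, started from the empty word and the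
letters in `as`. -/
def saturate [DecidableEq N] (as : List A) (h : A → N) (e n : ℕ) : List (N × List (List A)) :=
  (saturateStep e)^[n] ((1, [[]]) :: as.map fun a => (h a, [[a]]))

/-- The labelled set given by a labelled list of words. -/
def imageSet (α : List A → M) (x : N × List (List A)) : N × Set M :=
  (x.1, {t | ∃ w ∈ x.2, α w = t})

variable {α : List A → M}

theorem imageSet_one (h1 : α [] = 1) : imageSet α ((1, [[]]) : N × List (List A)) = 1 := by
  ext1
  · rfl
  · ext t
    simp [imageSet, h1, eq_comm]

theorem imageSet_listMul (hα : ∀ u v, α (u ++ v) = α u * α v) (x y : N × List (List A)) :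
    imageSet α (listMul x y) = imageSet α x * imageSet α y := by
  ext1
  · rfl
  · ext t
    simp only [imageSet, listMul, Prod.snd_mul, Set.mem_mul, Set.mem_ofPred_eq, List.mem_flatMap,
      List.mem_map]
    constructor
    · rintro ⟨_, ⟨u, hu, v, hv, rfl⟩, rfl⟩
      exact ⟨_, ⟨u, hu, rfl⟩, _, ⟨v, hv, rfl⟩, (hα u v).symm⟩
    · rintro ⟨_, ⟨u, hu, rfl⟩, _, ⟨v, hv, rfl⟩, rfl⟩
      exact ⟨_, ⟨u, hu, v, hv, rfl⟩, hα u v⟩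

theorem imageSet_listPow (h1 : α [] = 1) (hα : ∀ u v, α (u ++ v) = α u * α v)
    (x : N × List (List A)) (n : ℕ) : imageSet α (listPow x n) = imageSet α x ^ n := by
  induction n with
  | zero => rw [pow_zero]; exact imageSet_one h1
  | succ n ih => rw [listPow, Function.iterate_succ_apply', imageSet_listMul hα, pow_succ', ← ih,
      listPow]

theorem imageSet_listPump (h1 : α [] = 1) (hα : ∀ u v, α (u ++ v) = α u * α v) (e : ℕ)
    (x : N × List (List A)) : imageSet α (listPump e x) = pump e (imageSet α x) := by
  ext1
  · rfl
  · have h := congrArg Prod.snd (imageSet_listPow h1 hα x e)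
    have h' := congrArg Prod.snd (imageSet_listPow h1 hα x (e + 1))
    rw [Prod.pow_snd] at h h'
    change {t | ∃ w ∈ (listPow x e).2 ++ (listPow x (e + 1)).2, α w = t} = _ ∪ _
    rw [← h, ← h']
    ext t
    simp only [imageSet, List.mem_append, or_and_right, exists_or, Set.mem_ofPred_eq, Set.mem_union]

variable [DecidableEq N]

theorem mem_saturateStep {e : ℕ} {F : List (N × List (List A))} {z : N × List (List A)} :
    z ∈ saturateStep e F ↔ z ∈ F ∨ (∃ x ∈ F, ∃ y ∈ F, listMul x y = z) ∨
      ∃ x ∈ F, x.1 * x.1 = x.1 ∧ listPump e x = z := by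
  simp [saturateStep, and_assoc]

theorem pumpClosure_of_mem_saturate (h1 : α [] = 1) (hα : ∀ u v, α (u ++ v) = α u * α v)
    {as : List A} {h : A → N} {e n : ℕ} {z : N × List (List A)} (hz : z ∈ saturate as h e n) :
    imageSet α z = 1 ∨ PumpClosure e (fun a => (h a, ({α [a]} : Set M))) (imageSet α z) := by
  have hQ := isPumpClosed_pumpClosure e fun a => (h a, ({α [a]} : Set M))
  induction n generalizing z with
  | zero =>
    rcases List.mem_cons.1 hz with rfl | hz
    · exact Or.inl (imageSet_one h1)
    · obtain ⟨a, -, rfl⟩ := List.mem_map.1 hz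
      have : imageSet α (h a, [[a]]) = (h a, ({α [a]} : Set M)) := by
        ext1
        · rfl
        · ext t
          simp [imageSet, eq_comm]
      rw [this]
      exact Or.inr (.letter a)
  | succ n ih =>
    rw [saturate, Function.iterate_succ_apply', mem_saturateStep] at hz
    rcases hz with hz | ⟨x, hx, y, hy, rfl⟩ | ⟨x, hx, hxx, rfl⟩
    · exact ih hz
    · rw [imageSet_listMul hα]
      exact hQ.mul_mem_insert (ih hx) (ih hy)
    · rw [imageSet_listPump h1 hα]
      exact hQ.pump_mem_insert (ih hx) hxx

theorem mem_saturate_of_pumpClosure [Finite N] [Finite M] (h1 : α [] = 1)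
    (hα : ∀ u v, α (u ++ v) = α u * α v) {as : List A} (has : ∀ a, a ∈ as) {h : A → N} {e n : ℕ}
    (hn : Nat.card (N × Set M) ≤ n) {x : N × Set M}
    (hx : x = 1 ∨ PumpClosure e (fun a => (h a, ({α [a]} : Set M))) x) :
    ∃ z ∈ saturate as h e n, imageSet α z = x := by
  set S : ℕ → Set (N × Set M) := fun i => {x | ∃ z ∈ saturate as h e i, imageSet α z = x} with hS
  have hstep : ∀ i z, z ∈ saturateStep e (saturate as h e i) → imageSet α z ∈ S (i + 1) := by
    intro i z hz
    refine ⟨z, ?_, rfl⟩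
    rwa [saturate, Function.iterate_succ_apply']
  have hmono : Monotone S := by
    refine monotone_nat_of_le_succ fun i => ?_
    rintro _ ⟨z, hz, rfl⟩
    exact hstep i z (mem_saturateStep.2 (Or.inl hz))
  -- An increasing chain of subsets of `N × Set M` cannot grow strictly more often than there are
  -- elements. A stable stage is closed under both operations.
  obtain ⟨i, hi, hstable⟩ : ∃ i ≤ n, S (i + 1) = S i := by
    by_contra! hcon
    have hcard : ∀ i ≤ n + 1, i ≤ (S i).ncard := by
      intro i
      induction i with
      | zero => exact fun _ => Nat.zero_le _
      | succ i ih =>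
        intro hi
        have := Set.ncard_lt_ncard ((hmono i.le_succ).ssubset_of_ne (hcon i (by omega)).symm)
          (Set.toFinite _)
        have := ih (by omega)
        simp only [Nat.succ_eq_add_one] at *
        omega
    have h2 := hcard (n + 1) le_rfl
    have h3 := Set.ncard_le_card (S (n + 1))
    omega
  suffices hxi : x ∈ S i from hmono hi hxi
  have hbase : S 0 ⊆ S i := hmono (Nat.zero_le i)
  rcases hx with rfl | hx
  · exact hbase ⟨(1, [[]]), List.mem_cons_self, imageSet_one h1⟩
  · induction hx with
    | letter a =>
      refine hbase ⟨(h a, [[a]]), List.mem_cons_of_mem _ (List.mem_map.2 ⟨a, has a, rfl⟩), ?_⟩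
      ext1
      · rfl
      · ext t
        simp [imageSet, eq_comm]
    | mul x y _ _ hx hy =>
      obtain ⟨x, hx, rfl⟩ := hx
      obtain ⟨y, hy, rfl⟩ := hy
      rw [← hstable, ← imageSet_listMul hα]
      exact hstep i _ (mem_saturateStep.2 (Or.inr (Or.inl ⟨x, hx, y, hy, rfl⟩)))
    | pump x _ hxx hx =>
      obtain ⟨x, hx, rfl⟩ := hx
      rw [← hstable, ← imageSet_listPump h1 hα]
      exact hstep i _ (mem_saturateStep.2 (Or.inr (Or.inr ⟨x, hx, hxx, rfl⟩)))

end Saturation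

/-! ### Syntactic monoids of sets of languages. -/

section Syntactic

variable {A : Type u}

/-- The syntactic congruence of a set of languages. -/
def syntacticCon (Ks : Set (Language A)) : Con (FreeMonoid A) where
  r u v := ContextEquiv Ks u.toList v.toList
  iseqv := ⟨fun _ => .refl _ _, fun h => h.symm, fun h h' => h.trans h'⟩
  mul' h h' := h.append h'

/-- The syntactic monoid of a set of languages. -/
abbrev SyntacticMonoid (Ks : Set (Language A)) : Type u :=
  (syntacticCon Ks).Quotient

/-- The class of a word in the syntactic monoid. -/
def syntacticMap (Ks : Set (Language A)) (w : List A) : SyntacticMonoid Ks :=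
  (syntacticCon Ks).mk' (FreeMonoid.ofList w)

variable {Ks : Set (Language A)}

theorem syntacticMap_nil : syntacticMap Ks [] = 1 := rfl

theorem syntacticMap_append (u v : List A) :
    syntacticMap Ks (u ++ v) = syntacticMap Ks u * syntacticMap Ks v := rfl

theorem syntacticMap_eq_iff {u v : List A} :
    syntacticMap Ks u = syntacticMap Ks v ↔ ContextEquiv Ks u v :=
  (syntacticCon Ks).eq

theorem syntacticMap_surjective : Function.Surjective (syntacticMap Ks) := fun m => by
  obtain ⟨w, rfl⟩ := Con.mk'_surjective m
  exact ⟨w.toList, rfl⟩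

theorem mem_recognized_syntacticMap {K : Language A} (hK : K ∈ Ks) :
    K ∈ recognized (syntacticMap Ks) := by
  refine ⟨syntacticMap Ks '' K, ?_⟩
  ext w
  constructor
  · exact fun hw => ⟨w, hw, rfl⟩
  · rintro ⟨v, hv, hvw⟩
    have := syntacticMap_eq_iff.1 hvw K hK [] []
    simp only [List.nil_append, List.append_nil] at this
    exact this.1 hv

/-- A map on words whose kernel refines the syntactic congruence bounds the syntactic monoid. -/
theorem exists_injective_syntacticMonoid {β : Type*} (f : List A → β)
    (hf : ∀ u v, f u = f v → ContextEquiv Ks u v) :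
    ∃ φ : SyntacticMonoid Ks → β, Function.Injective φ := by
  choose r hr using syntacticMap_surjective (Ks := Ks)
  refine ⟨fun m => f (r m), fun m m' h => ?_⟩
  rw [← hr m, ← hr m']
  exact syntacticMap_eq_iff.2 (hf _ _ h)

theorem IsPrevariety.contextEquiv {C : Set (Language A)} (hC : IsPrevariety C) {u v : List A}
    (h : ∀ L ∈ C, u ∈ L ↔ v ∈ L) : ContextEquiv C u v := by
  intro L hL x y
  have := h _ (hC.rightQuotient_mem _ (hC.leftQuotient_mem L hL x) y)
  change x ++ (u ++ y) ∈ L ↔ x ++ (v ++ y) ∈ L at this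
  rwa [List.append_assoc, List.append_assoc]

/-- Since `C` is closed under quotients, the class of a word is determined by the set of members of
`C` that contain it. -/
theorem IsPrevariety.finite_syntacticMonoid {C : Set (Language A)} (hC : IsPrevariety C)
    (hfin : C.Finite) : Finite (SyntacticMonoid C) := by
  have : Finite C := hfin
  obtain ⟨φ, hφ⟩ := exists_injective_syntacticMonoid (Ks := C)
    (fun w => ({L | w ∈ L.1} : Set C)) fun u v h => hC.contextEquiv fun L hL => by
      have := Set.ext_iff.1 h ⟨L, hL⟩
      exact this
  exact Finite.of_injective φ hφ

theorem IsPrevariety.recognized_syntacticMap_subset {C : Set (Language A)} (hC : IsPrevariety C)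
    (hfin : C.Finite) : recognized (syntacticMap C) ⊆ SF C := by
  rintro _ ⟨F, rfl⟩
  have := hC.finite_syntacticMonoid hfin
  have hbot : InSF C ⊥ := .base _ hC.empty_mem
  have h : ({w | syntacticMap C w ∈ F} : Language A) =
      {w | ∃ m ∈ F, w ∈ ({w | syntacticMap C w = m} : Language A)} := by
    ext w
    exact ⟨fun hw => ⟨_, hw, rfl⟩, fun ⟨m, hm, hw⟩ => by
      have hw : syntacticMap C w = m := hw
      change syntacticMap C w ∈ F
      rwa [hw]⟩
  rw [h]
  refine InSF.biUnion (Set.toFinite F) hbot fun m _ => ?_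
  obtain ⟨u, rfl⟩ := syntacticMap_surjective m
  -- A syntactic class is a finite Boolean combination of members of `C`.
  have h2 : ({w | syntacticMap C w = syntacticMap C u} : Language A) =
      ({w | ∃ L ∈ C, w ∈ ({w | ¬ (w ∈ L ↔ u ∈ L)} : Language A)} : Language A)ᶜ := by
    ext w
    change syntacticMap C w = syntacticMap C u ↔ ¬ ∃ L ∈ C, ¬ (w ∈ L ↔ u ∈ L)
    push Not
    rw [syntacticMap_eq_iff]
    refine ⟨fun h L hL => ?_, fun h => hC.contextEquiv fun L hL => ?_⟩
    · simpa only [List.nil_append, List.append_nil] using h L hL [] []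
    · have := h L hL
      tauto
  rw [h2]
  refine .compl _ (.biUnion hfin hbot fun L hL => ?_)
  by_cases hu : u ∈ L
  · have h3 : ({w | ¬ (w ∈ L ↔ u ∈ L)} : Language A) = Lᶜ := by
      ext w
      change ¬ (w ∈ L ↔ u ∈ L) ↔ w ∉ L
      simp [hu]
    rw [h3]
    exact InSF.compl L (.base _ hL)
  · have h3 : ({w | ¬ (w ∈ L ↔ u ∈ L)} : Language A) = L := by
      ext w
      change ¬ (w ∈ L ↔ u ∈ L) ↔ w ∈ L
      simp [hu]
    rw [h3]
    exact InSF.base L hL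

end Syntactic

/-! ### Automata codes and a bound for their syntactic monoid. -/

section Automata

variable {A : Type u}

/-- The states that are initial or the target of a transition. -/
def AutomatonCode.states (c : AutomatonCode A) : List ℕ :=
  c.2.1 ++ c.1.map fun t => t.2.2

/-- The states reached from the states in `S` by reading `a`. -/
def AutomatonCode.next [DecidableEq A] (c : AutomatonCode A) (S : List ℕ) (a : A) : List ℕ :=
  (c.1.filter fun t => t.2.1 = a ∧ ∃ q ∈ S, q = t.1).map fun t => t.2.2

theorem AutomatonCode.evalFrom_toNFA [DecidableEq A] (c : AutomatonCode A) (S : List ℕ)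
    (w : List A) : (AutomatonCode.toNFA c).evalFrom {q | q ∈ S} w =
      {q | q ∈ w.foldl (AutomatonCode.next c) S} := by
  induction w generalizing S with
  | nil => rfl
  | cons a w ih =>
    rw [NFA.evalFrom_cons, List.foldl_cons, ← ih]
    congr 1
    ext q
    simp only [NFA.mem_stepSet, AutomatonCode.next, List.mem_map, List.mem_filter,
      decide_eq_true_eq]
    constructor
    · rintro ⟨p, hp, hpq⟩
      exact ⟨(p, a, q), ⟨hpq, rfl, p, hp, rfl⟩, rfl⟩
    · rintro ⟨⟨p, a', q'⟩, ⟨ht, rfl, p', hp, rfl⟩, rfl⟩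
      exact ⟨_, hp, ht⟩

theorem AutomatonCode.mem_language_iff [DecidableEq A] (c : AutomatonCode A) (w : List A) :
    w ∈ AutomatonCode.language c ↔
      ∃ q ∈ w.foldl (AutomatonCode.next c) c.2.1, ∃ q' ∈ c.2.2, q' = q := by
  have h := AutomatonCode.evalFrom_toNFA c c.2.1 w
  change (∃ q ∈ (AutomatonCode.toNFA c).accept, q ∈ (AutomatonCode.toNFA c).evalFrom _ w) ↔ _
  change (∃ q ∈ c.2.2, q ∈ (AutomatonCode.toNFA c).evalFrom {q | q ∈ c.2.1} w) ↔ _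
  rw [h]
  exact ⟨fun ⟨q, hq, h⟩ => ⟨q, h, q, hq, rfl⟩, fun ⟨q, h, q', hq, e⟩ => ⟨q, e ▸ hq, h⟩⟩

theorem AutomatonCode.evalFrom_subset (c : AutomatonCode A) {X : Set ℕ}
    (hX : ∀ q ∈ AutomatonCode.states c, q ∈ X) {S : Set ℕ} (hS : S ⊆ X) (w : List A) :
    (AutomatonCode.toNFA c).evalFrom S w ⊆ X := by
  induction w generalizing S with
  | nil => exact hS
  | cons a w ih =>
    rw [NFA.evalFrom_cons]
    refine ih fun q hq => ?_
    obtain ⟨p, -, hpq⟩ := NFA.mem_stepSet.1 hq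
    exact hX q (List.mem_append_right _ (List.mem_map.2 ⟨_, hpq, rfl⟩))

/-- A bound for the cardinality of the syntactic monoid of the languages of the automata `cs`. -/
def cardBound (cs : List (AutomatonCode A)) : ℕ :=
  ((2 ^ (cs.flatMap AutomatonCode.states).length) ^
    2 ^ (cs.flatMap AutomatonCode.states).length) ^ cs.length

theorem syntacticMonoid_bound (cs : List (AutomatonCode A)) :
    Finite (SyntacticMonoid {L | ∃ c ∈ cs, AutomatonCode.language c = L}) ∧
    Nat.card (SyntacticMonoid {L | ∃ c ∈ cs, AutomatonCode.language c = L}) ≤ cardBound cs := by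
  set X : Set ℕ := {q | q ∈ cs.flatMap AutomatonCode.states} with hX
  have hXeq : X = ((cs.flatMap AutomatonCode.states).toFinset : Set ℕ) := by
    ext q
    simp [hX]
  have hXfin : X.Finite := by rw [hXeq]; exact Finset.finite_toSet _
  have : Finite X := hXfin
  have hXcard : Nat.card X ≤ (cs.flatMap AutomatonCode.states).length := by
    rw [Nat.card_coe_set_eq, hXeq, Set.ncard_coe_finset]
    exact List.toFinset_card_le _
  obtain ⟨φ, hφ⟩ := exists_injective_syntacticMonoid
    (Ks := {L | ∃ c ∈ cs, AutomatonCode.language c = L})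
    -- Each word is sent to its action on sets of occurring states, one action per automaton;
    -- `cardBound` counts these families.
    (fun w => fun (i : Fin cs.length) (S : Set X) =>
      ({q | q.1 ∈ (AutomatonCode.toNFA cs[i]).evalFrom (Subtype.val '' S) w} : Set X)) (by
    rintro u v huv _ ⟨c, hc, rfl⟩ x y
    obtain ⟨i, hi, rfl⟩ := List.mem_iff_getElem.1 hc
    have hstates : ∀ q ∈ AutomatonCode.states cs[i], q ∈ X :=
      fun q hq => List.mem_flatMap.2 ⟨_, List.getElem_mem hi, hq⟩
    set T : Set ℕ := (AutomatonCode.toNFA cs[i]).evalFrom (AutomatonCode.toNFA cs[i]).start x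
      with hT
    have hTX : T ⊆ X := AutomatonCode.evalFrom_subset _ hstates
      (fun q hq => hstates q (List.mem_append_left _ hq)) x
    have hT' : Subtype.val '' (Subtype.val ⁻¹' T : Set X) = T := by
      rw [Subtype.image_preimage_coe, Set.inter_eq_right.2 hTX]
    have key : (AutomatonCode.toNFA cs[i]).evalFrom T u =
        (AutomatonCode.toNFA cs[i]).evalFrom T v := by
      have h := congrFun (congrFun huv ⟨i, hi⟩) (Subtype.val ⁻¹' T)
      simp only [hT', Fin.getElem_fin] at h
      ext q
      constructor
      · intro hq
        have := (Set.ext_iff.1 h ⟨q, AutomatonCode.evalFrom_subset _ hstates hTX u hq⟩).1 hq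
        exact this
      · intro hq
        have := (Set.ext_iff.1 h ⟨q, AutomatonCode.evalFrom_subset _ hstates hTX v hq⟩).2 hq
        exact this
    change (∃ q ∈ _, q ∈ NFA.evalFrom _ _ _) ↔ (∃ q ∈ _, q ∈ NFA.evalFrom _ _ _)
    simp only [NFA.evalFrom_append]
    rw [← hT, key])
  refine ⟨Finite.of_injective φ hφ, (Nat.card_le_card_of_injective φ hφ).trans ?_⟩
  rw [Nat.card_fun, Nat.card_fun, Nat.card_fin, cardBound]
  have hset : Nat.card (Set X) = 2 ^ Nat.card X := by
    have : Fintype X := Fintype.ofFinite X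
    rw [Nat.card_eq_fintype_card, Fintype.card_set, Nat.card_eq_fintype_card]
  have hle : Nat.card (Set X) ≤ 2 ^ (cs.flatMap AutomatonCode.states).length := by
    rw [hset]
    exact Nat.pow_le_pow_right two_pos hXcard
  exact Nat.pow_le_pow_left ((Nat.pow_le_pow_left hle _).trans
    (Nat.pow_le_pow_right (by positivity) hle)) _

end Automata

/-! ### Primitive recursiveness of the procedure and decidability. -/

section Computability

theorem primrec_nat_pow : Primrec₂ ((· ^ ·) : ℕ → ℕ → ℕ) :=
  Primrec₂.unpaired'.1 Nat.Primrec.pow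

theorem primrec_factorial : Primrec Nat.factorial := by
  refine (Primrec.nat_rec₁ (f := fun n r => (n + 1) * r) 1
    (Primrec.nat_mul.comp (Primrec.succ.comp .fst) .snd)).of_eq fun n => ?_
  induction n with
  | zero => rfl
  | succ n ih => rw [Nat.factorial_succ, ← ih]

variable {A : Type*} [Primcodable A]

theorem primrec_states : Primrec (AutomatonCode.states (A := A)) :=
  Primrec.list_append.comp (.comp .fst .snd)
    (.list_map .fst (Primrec.to₂ (.comp .snd (.comp .snd .snd))))

theorem primrec_cardBound : Primrec (cardBound (A := A)) := by
  have h : Primrec fun cs : List (AutomatonCode A) => (cs.flatMap AutomatonCode.states).length :=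
    Primrec.list_length.comp (.list_flatMap .id (primrec_states.comp₂ .right))
  have h2 := primrec_nat_pow.comp (.const 2) h
  exact primrec_nat_pow.comp (primrec_nat_pow.comp h2 h2) .list_length

theorem primrec_next [DecidableEq A] : Primrec fun x : AutomatonCode A × List ℕ × A =>
    AutomatonCode.next x.1 x.2.1 x.2.2 := by
  have hmem : PrimrecRel fun (S : List ℕ) (p : ℕ) => ∃ q ∈ S, q = p :=
    PrimrecRel.exists_mem_list Primrec.eq
  have hR : PrimrecRel fun (t : ℕ × A × ℕ) (x : List ℕ × A) =>
      t.2.1 = x.2 ∧ ∃ q ∈ x.1, q = t.1 :=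
    PrimrecPred.and
      (PrimrecRel.comp Primrec.eq (.comp .fst (.comp .snd .fst)) (.comp .snd .snd))
      (hmem.comp (.comp .fst .snd) (.comp .fst .fst))
  exact .list_map (hR.listFilter.comp (.comp .fst .fst) .snd)
    (Primrec.to₂ (.comp .snd (.comp .snd .snd)))

theorem primrec_mem_language :
    PrimrecRel fun (w : List A) (c : AutomatonCode A) => w ∈ AutomatonCode.language c := by
  classical
  have hfold : Primrec fun x : List A × AutomatonCode A =>
      x.1.foldl (AutomatonCode.next x.2) x.2.2.1 :=
    .list_foldl .fst (.comp .fst (.comp .snd .snd))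
      (Primrec.to₂ (primrec_next.comp (.pair (.comp .snd .fst) .snd)))
  have hmem : PrimrecRel fun (S : List ℕ) (p : ℕ) => ∃ q ∈ S, q = p :=
    PrimrecRel.exists_mem_list Primrec.eq
  have hacc : PrimrecRel fun (S T : List ℕ) => ∃ q ∈ S, ∃ q' ∈ T, q' = q :=
    PrimrecRel.exists_mem_list (hmem.comp .snd .fst)
  refine (PrimrecRel.comp hacc hfold (.comp .snd (.comp .snd .snd))).of_eq fun x => ?_
  exact (AutomatonCode.mem_language_iff x.2 x.1).symm

variable {N : Type*} [Primcodable N] [Finite N] [Monoid N]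

theorem primrec_listMul : Primrec₂ (listMul : N × List (List A) → _ → _) := by
  have hmul : Primrec₂ ((· * ·) : N → N → N) := .dom_finite _
  refine Primrec.pair (hmul.comp (.comp .fst .fst) (.comp .fst .snd)) ?_
  refine .list_flatMap (.comp .snd .fst) ?_
  refine .list_map (.comp .snd (.comp .snd .fst)) ?_
  exact Primrec.list_append.comp (.comp .snd .fst) .snd

theorem primrec_listPow : Primrec₂ (listPow : N × List (List A) → ℕ → _) :=
  .nat_iterate .snd (.const _) (primrec_listMul.comp (.comp .fst .fst) .snd)

theorem primrec_listPump : Primrec₂ (listPump : ℕ → N × List (List A) → _) :=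
  Primrec.pair (.comp .fst .snd) (Primrec.list_append.comp
    (.comp .snd (primrec_listPow.comp .snd .fst))
    (.comp .snd (primrec_listPow.comp .snd (.comp .succ .fst))))

theorem primrec_saturateStep [DecidableEq N] :
    Primrec₂ (saturateStep : ℕ → List (N × List (List A)) → _) := by
  have hidem : PrimrecPred fun x : N × List (List A) => x.1 * x.1 = x.1 := by
    have h : Primrec fun n : N => n * n := .dom_finite _
    exact PrimrecRel.comp Primrec.eq (h.comp .fst) .fst
  refine Primrec.list_append.comp .snd (Primrec.list_append.comp ?_ ?_)
  · refine .list_flatMap .snd (.list_map (.comp .snd .fst) ?_)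
    exact primrec_listMul.comp (.comp .snd .fst) .snd
  · exact .list_map ((Primrec.listFilter hidem).comp .snd)
      (primrec_listPump.comp (.comp .fst .fst) .snd)

theorem primrec_saturate [DecidableEq N] (as : List A) (h : A → N) :
    Primrec₂ fun e n : ℕ => saturate as h e n :=
  .nat_iterate .snd (.const _) (primrec_saturateStep.comp (.comp .fst .fst) .snd)

end Computability

/-- As `k` bounds the size of `N × Set M`, the exponent `k!` makes powers idempotent and `k` rounds
suffice. Since `α` recognizes the input languages, the obstruction test reduces to running the
automata on the listed words. -/
theorem IsPrevariety.coverable_iff {A : Type u} [Finite A] {C : Set (Language A)}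
    [DecidableEq (SyntacticMonoid C)] (hC : IsPrevariety C) (hfin : C.Finite) {as : List A}
    (has : ∀ a, a ∈ as) (c : AutomatonCode A) (cs : List (AutomatonCode A)) {k : ℕ}
    (hk : Nat.card (SyntacticMonoid C) * 2 ^ cardBound (c :: cs) ≤ k) :
    Coverable (SF C) (AutomatonCode.language c) {L | ∃ c ∈ cs, AutomatonCode.language c = L} ↔
      ¬ ∃ z ∈ saturate as (fun a => syntacticMap C [a]) k.factorial k,
        (∃ w ∈ z.2, w ∈ AutomatonCode.language c) ∧
          ∀ d ∈ cs, ∃ w ∈ z.2, w ∈ AutomatonCode.language d := by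
  have := hC.finite_syntacticMonoid hfin
  obtain ⟨hM, hMcard⟩ := syntacticMonoid_bound (c :: cs)
  set Ks : Set (Language A) := {L | ∃ d ∈ c :: cs, AutomatonCode.language d = L} with hKs
  have hcard : Nat.card (SyntacticMonoid C × Set (SyntacticMonoid Ks)) ≤ k := by
    have hset : Nat.card (Set (SyntacticMonoid Ks)) = 2 ^ Nat.card (SyntacticMonoid Ks) := by
      have : Fintype (SyntacticMonoid Ks) := Fintype.ofFinite _
      rw [Nat.card_eq_fintype_card, Fintype.card_set, Nat.card_eq_fintype_card]
    rw [Nat.card_prod, hset]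
    exact (Nat.mul_le_mul_left _ (Nat.pow_le_pow_right two_pos hMcard)).trans hk
  have hrec : ∀ d ∈ c :: cs, AutomatonCode.language d ∈ recognized (syntacticMap Ks) :=
    fun d hd => mem_recognized_syntacticMap ⟨d, hd, rfl⟩
  have hmem : ∀ d ∈ c :: cs, ∀ z : SyntacticMonoid C × List (List A),
      (∃ w ∈ AutomatonCode.language d, syntacticMap Ks w ∈ (imageSet (syntacticMap Ks) z).2) ↔
        ∃ w ∈ z.2, w ∈ AutomatonCode.language d := by
    intro d hd z
    obtain ⟨F, hF⟩ := hrec d hd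
    rw [hF]
    constructor
    · rintro ⟨w, hw, v, hv, hvw⟩
      refine ⟨v, hv, ?_⟩
      change syntacticMap Ks v ∈ F
      rw [hvw]
      exact hw
    · rintro ⟨w, hw, hwF⟩
      exact ⟨w, hwF, w, hw, rfl⟩
  rw [StarFreeClosure.coverable_iff syntacticMap_nil syntacticMap_nil syntacticMap_append
    syntacticMap_append (fun L hL => mem_recognized_syntacticMap hL)
    (hC.recognized_syntacticMap_subset hfin) k.factorial_ne_zero
    (fun x => pow_factorial_mul_self hcard x) (hrec c List.mem_cons_self) (by
      rintro _ ⟨d, hd, rfl⟩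
      exact hrec d (List.mem_cons_of_mem _ hd)), not_iff_not]
  constructor
  · rintro ⟨x, hx, hx1, hx2⟩
    obtain ⟨z, hz, rfl⟩ := mem_saturate_of_pumpClosure syntacticMap_nil syntacticMap_append has
      hcard hx
    exact ⟨z, hz, (hmem c List.mem_cons_self z).1 hx1,
      fun d hd => (hmem d (List.mem_cons_of_mem _ hd) z).1 (hx2 _ ⟨d, hd, rfl⟩)⟩
  · rintro ⟨z, hz, hz1, hz2⟩
    refine ⟨_, pumpClosure_of_mem_saturate syntacticMap_nil syntacticMap_append hz,
      (hmem c List.mem_cons_self z).2 hz1, ?_⟩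
    rintro _ ⟨d, hd, rfl⟩
    exact (hmem d (List.mem_cons_of_mem _ hd) z).2 (hz2 d hd)

theorem IsPrevariety.coveringDecidable {A : Type u} [Finite A] [Primcodable A]
    {C : Set (Language A)} (hC : IsPrevariety C) (hfin : C.Finite) :
    CoveringDecidable (SF C) := by
  classical
  have := hC.finite_syntacticMonoid hfin
  -- `C` is not part of the input, so its monoid is a fixed finite table and any encoding will do.
  let _ : Primcodable (SyntacticMonoid C) := Primcodable.ofEquiv _ (Finite.equivFin _)
  have : Fintype A := Fintype.ofFinite A
  set k : AutomatonCode A × List (AutomatonCode A) → ℕ :=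
    fun x => Nat.card (SyntacticMonoid C) * 2 ^ cardBound (x.1 :: x.2) with hk
  have hkp : Primrec k :=
    Primrec.nat_mul.comp (.const _) (primrec_nat_pow.comp (.const 2)
      (primrec_cardBound.comp (Primrec.list_cons.comp .fst .snd)))
  have hacc : PrimrecRel fun (z : SyntacticMonoid C × List (List A)) (d : AutomatonCode A) =>
      ∃ w ∈ z.2, w ∈ AutomatonCode.language d :=
    (PrimrecRel.exists_mem_list primrec_mem_language).comp (.comp .snd .fst) .snd
  have hall : PrimrecRel fun (z : SyntacticMonoid C × List (List A))
      (x : AutomatonCode A × List (AutomatonCode A)) =>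
      (∃ w ∈ z.2, w ∈ AutomatonCode.language x.1) ∧
        ∀ d ∈ x.2, ∃ w ∈ z.2, w ∈ AutomatonCode.language d := by
    refine PrimrecPred.and (PrimrecRel.comp hacc .fst (.comp .fst .snd)) ?_
    exact (PrimrecRel.forall_mem_list hacc.swap).comp (.comp .snd .snd) .fst
  have hex := (PrimrecRel.exists_mem_list hall).comp
    ((primrec_saturate (Finset.univ : Finset A).toList fun a => syntacticMap C [a]).comp
      (primrec_factorial.comp hkp) hkp) .id
  obtain ⟨hd, hp⟩ := hex.not
  refine ComputablePred.of_eq ⟨hd, hp.to_comp⟩ fun x => ?_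
  exact (hC.coverable_iff hfin (by simp) x.1 x.2 le_rfl).symm

/-! ### Reduction of separation to covering, and the star-free case. -/

theorem separable_iff_coverable {A : Type*} {D : Set (Language A)} (hbot : ⊥ ∈ D)
    (hsup : ∀ K ∈ D, ∀ L ∈ D, K ⊔ L ∈ D) (L₁ L₂ : Language A) :
    Separable D L₁ L₂ ↔ Coverable D L₁ {L₂} := by
  constructor
  · rintro ⟨K, hK, h1, h2⟩
    refine ⟨{K}, ⟨Set.finite_singleton K, fun w hw => ⟨K, rfl, h1 hw⟩⟩, by simpa using hK, ?_⟩
    rintro _ rfl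
    exact ⟨L₂, rfl, by rw [inf_comm]; exact h2⟩
  · rintro ⟨Ks, ⟨hfin, hcov⟩, hKs, hsep⟩
    have hsep' : ∀ K ∈ Ks, K ⊓ L₂ = ⊥ := fun K hK => by
      obtain ⟨_, rfl, h⟩ := hsep K hK
      exact h
    have hunion : ∀ Ks : Set (Language A), Ks.Finite → Ks ⊆ D → sSup Ks ∈ D := by
      intro Ks hfin
      induction Ks, hfin using Set.Finite.induction_on with
      | empty => exact fun _ => by rwa [sSup_empty]
      | @insert K Ks _ _ ih =>
        intro h
        rw [sSup_insert]
        exact hsup _ (h (Or.inl rfl)) _ (ih fun L hL => h (Or.inr hL))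
    refine ⟨sSup Ks, hunion Ks hfin hKs, fun w hw => ?_, ?_⟩
    · obtain ⟨K, hK, hwK⟩ := hcov w hw
      exact le_sSup hK hwK
    · rw [eq_bot_iff]
      rintro w ⟨hw, K, hK, hwK⟩
      rw [← hsep' K hK]
      exact ⟨hwK, hw⟩

theorem separationDecidable_of_coveringDecidable {A : Type*} [Primcodable A]
    {D : Set (Language A)} (hbot : ⊥ ∈ D) (hsup : ∀ K ∈ D, ∀ L ∈ D, K ⊔ L ∈ D)
    (h : CoveringDecidable D) : SeparationDecidable D := by
  refine ComputablePred.computable_of_manyOneReducible ⟨fun x => (x.1, [x.2]),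
    (Primrec.pair .fst (Primrec.list_cons.comp .snd (.const []))).to_comp, fun x => ?_⟩ h
  have hset : {L | ∃ c ∈ [x.2], AutomatonCode.language c = L} =
      ({AutomatonCode.language x.2} : Set (Language A)) := by
    ext L
    simp [eq_comm]
  change Separable D _ _ ↔ Coverable D _ {L | ∃ c ∈ [x.2], AutomatonCode.language c = L}
  rw [hset, separable_iff_coverable hbot hsup]

theorem isPrevariety_bot_top {A : Type*} : IsPrevariety ({⊥, ⊤} : Set (Language A)) where
  empty_mem := Or.inl rfl
  univ_mem := Or.inr rfl
  union_mem := by rintro K (rfl | rfl) L (rfl | rfl) <;> simp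
  inter_mem := by rintro K (rfl | rfl) L (rfl | rfl) <;> simp
  compl_mem := by rintro K (rfl | rfl) <;> simp
  leftQuotient_mem := by
    rintro L (rfl | rfl) u
    · exact Or.inl rfl
    · exact Or.inr rfl
  rightQuotient_mem := by
    rintro L (rfl | rfl) u
    · exact Or.inl rfl
    · exact Or.inr rfl
  regular := by
    have h : (⊥ : Language A).IsRegular :=
      ⟨Unit, inferInstance, ⟨fun _ _ => (), (), ∅⟩, rfl⟩
    rintro L (rfl | rfl)
    · exact h
    · rw [← compl_bot]
      exact h.compl

theorem starFreeLanguages_eq_SF (A : Type*) [Finite A] :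
    starFreeLanguages A = SF ({⊥, ⊤} : Set (Language A)) := by
  have hbot : InSF ({⊥, ⊤} : Set (Language A)) ⊥ := .base _ (Or.inl rfl)
  have htop : InSF ({⊥, ⊤} : Set (Language A)) ⊤ := .base _ (Or.inr rfl)
  ext L
  constructor
  · rintro ⟨e, rfl⟩
    change InSF _ _
    induction e with
    | empty => exact hbot
    | epsilon => exact .nil hbot htop
    | letter a => exact .letter a
    | union e f he hf => exact .union _ _ he hf
    | concat e f he hf => exact .concat _ _ he hf
    | compl e he => exact .compl _ he
  · intro h
    induction (show InSF _ _ from h) with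
    | base L hL =>
      rcases hL with rfl | rfl
      · exact ⟨.empty, rfl⟩
      · exact ⟨.compl .empty, compl_bot⟩
    | letter a => exact ⟨.letter a, rfl⟩
    | union K L hK hL ihK ihL =>
      obtain ⟨e, rfl⟩ := ihK hK
      obtain ⟨f, rfl⟩ := ihL hL
      exact ⟨.union e f, rfl⟩
    | compl K hK ihK =>
      obtain ⟨e, rfl⟩ := ihK hK
      exact ⟨.compl e, rfl⟩
    | concat K L hK hL ihK ihL =>
      obtain ⟨e, rfl⟩ := ihK hK
      obtain ⟨f, rfl⟩ := ihL hL
      exact ⟨.concat e f, rfl⟩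

end StarFreeClosure

theorem corollary9p3 {A : Type*} [Finite A] [Primcodable A] :
    (∀ C : Set (Language A), StarFreeClosure.IsPrevariety C → C.Finite →
      StarFreeClosure.CoveringDecidable (StarFreeClosure.SF C) ∧
      StarFreeClosure.SeparationDecidable (StarFreeClosure.SF C)) ∧
    StarFreeClosure.CoveringDecidable (StarFreeClosure.starFreeLanguages A) := by
  refine ⟨fun C hC hfin => ⟨hC.coveringDecidable hfin,
    StarFreeClosure.separationDecidable_of_coveringDecidable (.base _ hC.empty_mem)
      (fun K hK L hL => .union K L hK hL) (hC.coveringDecidable hfin)⟩, ?_⟩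
  rw [StarFreeClosure.starFreeLanguages_eq_SF]
  exact StarFreeClosure.isPrevariety_bot_top.coveringDecidable (Set.toFinite _)
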